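/- Conventions. A continuum is a nonempty connected compact metric space; a point $x$ of a continuum $X$ is a cut-point if $X\setminus\{x\}$ is disconnected (the empty set does not count as disconnected). For finite sequences $\vec S=(S_1,\dots,S_k)$ and $\vec T=(T_1,\dots,T_l)$ of subsets of $X$ and $Y$, $(X,\vec S)\cong(Y,\vec T)$ means that $k=l$ and there is a homeomorphism $f:X\to Y$ with $f[S_i]=T_i$ for all $i$. (1) Adding isolated points. Let $Z$ be a compact metrizable space and $A\subseteq Z$ a closed set. A set $D\subseteq Z\times(0,1]$ is admissible for $(Z,A)$ if $D\neq\emptyset$, every point of $D$ is isolated in $I(Z,A;D):=(Z\times\{0\})\cup D\subseteq Z\times[0,1]$, $\overline D\setminus D=A\times\{0\}$, and $D$ is a singleton in case $A=\emptyset$. Admissible sets exist, and $Z$ is identified with the subspace $Z\times\{0\}$ of $I(Z,A;D)$. (2) The coding space $I(X,\vec S)$. For closed sets $A_1\subseteq\dots\subseteq A_n$ of $X$ put $I_0=X$ and, for $0\le j<n$, let $I_{j+1}=I(I_j,\,(I_j\setminus X)\cup A_{j+1};\,D_{j+1})$ with any $D_{j+1}$ admissible for $(I_j,(I_j\setminus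 X)\cup A_{j+1})$. With $\vec S=(S_1,\dots,S_k)$ associate an increasing sequence of length $2^k-1$ recursively: to the empty sequence associate the empty sequence, and if $B_1\subseteq\dots\subseteq B_m$ (with $m=2^{j}-1$) is associated with $(S_1,\dots,S_j)$, then $$B_1\cap S_{j+1},\ \dots,\ B_m\cap S_{j+1},\ S_{j+1},\ B_1\cup S_{j+1},\ \dots,\ B_m\cup S_{j+1}$$ is associated with $(S_1,\dots,S_{j+1})$. If $A_1\subseteq\dots\subseteq A_{2^k-1}$ is associated with $\vec S$, then $I(X,\vec S)$ denotes any resulting space $I_{2^k-1}$. (3) The connected coding space $J(X,\vec S)$. The fan space $F_Z$ of a compact metrizable space $Z$ is the quotient of $Z\times[0,1]$ in which $Z\times\{1\}$ is collapsed to a point; for a closed $A\subseteq Z$, $F(Z,A)=\{[(z,s)]\in F_Z : s=0\text{ or }z\in A\}$. Put $D=I(X,\vec S)\setminus X$ and $J(X,\vec S)=F(I(X,\vec S),\overline D)$, the closure being taken in $I(X,\vec S)$. Theorem. Let $X,Y$ be continua without cut-points, and let $\vec S,\vec T$ be finite (possibly empty) sequences of closed subsets of $X$ and $Y$ respectively,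 such that every $S_i$ contains all isolated points of $X$ and every $T_i$ contains all isolated points of $Y$ (this is automatic when $X$ and $Y$ have more than one point). Then, for all choices of the admissible sets in the constructions of $I(X,\vec S)$ and $I(Y,\vec T)$, the following are equivalent: (i) $(X,\vec S)\cong(Y,\vec T)$; (ii) $J(X,\vec S)$ and $J(Y,\vec T)$ are homeomorphic. -/

import Mathlib

open Set Topology unitInterval

universe u v

/-- `x` is a cut-point of `X` if `X - {x}` is disconnected, i.e. splits into two nonempty
relatively open pieces (the empty set is not disconnected). -/
def IsCutPoint {X : Type u} [TopologicalSpace X] (x : X) : Prop :=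
  ¬ IsPreconnected ({x}ᶜ : Set X)

/-- `(X, S₁, …, Sₖ) ≅ (Y, T₁, …, Tₗ)`: the sequences have the same length and some homeomorphism
`f : X → Y` satisfies `f[Sᵢ] = Tᵢ` for all `i`. -/
def SeqHomeomorphic {X : Type u} {Y : Type v} [TopologicalSpace X] [TopologicalSpace Y]
    (S : List (Set X)) (T : List (Set Y)) : Prop :=
  ∃ f : X ≃ₜ Y, List.Forall₂ (fun A B => f '' A = B) S T

/-- The increasing sequence `A₁ ⊆ ⋯ ⊆ A_{2ᵏ - 1}` attached to `S₁, …, Sₖ`: it starts from the empty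
sequence, and adding a set `C` to the `S`'s turns `B₁, …, Bₘ` into
`B₁ ∩ C, …, Bₘ ∩ C, C, B₁ ∪ C, …, Bₘ ∪ C`. -/
def increasingSeq {X : Type u} (S : List (Set X)) : List (Set X) :=
  S.foldl (fun B C => B.map (fun b => b ∩ C) ++ C :: B.map (fun b => b ∪ C)) []

/-- The subspace `I(Z, A; D) = Z × {0} ∪ D` of `Z × [0, 1]`. -/
def codeSet {Z : Type u} (D : Set (Z × I)) : Set (Z × I) :=
  {p | p.2 = 0} ∪ D

/-- `D` is an admissible set of added points for the pair `(Z, A)`: `D ⊆ Z × (0, 1]` is a nonempty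
set of isolated points with `closure D - D = A × {0}`, and `D` is a singleton when `A` is empty. -/
structure IsAdmissible {Z : Type u} [TopologicalSpace Z] (A : Set Z) (D : Set (Z × I)) :
    Prop where
  pos : ∀ p ∈ D, 0 < p.2
  nonempty : D.Nonempty
  isolated : ∀ p ∈ D, ∃ U : Set (Z × I), IsOpen U ∧ U ∩ codeSet D = {p}
  closure_diff : closure D \ D = A ×ˢ {0}
  singleton_of_empty : A = ∅ → ∃ p, D = {p}

/-- A topological space together with a map from `X` (below: the natural copy of `X` in an iterated
coding space). -/
structure SpaceOver (X : Type u) where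
  carrier : Type u
  [top : TopologicalSpace carrier]
  base : X → carrier

attribute [instance] SpaceOver.top

namespace SpaceOver

variable {X : Type u}

/-- `X` over itself. -/
def self (X : Type u) [TopologicalSpace X] : SpaceOver X where
  carrier := X
  base := id

/-- The set of all points that have been added to `X`. -/
def added (E : SpaceOver X) : Set E.carrier := (range E.base)ᶜ

/-- The space `I(E, A; D) = E × {0} ∪ D`, with `X` sitting in it through `E × {0}`. -/
def attach (E : SpaceOver X) (D : Set (E.carrier × I)) : SpaceOver X where
  carrier := codeSet D
  base x := ⟨(E.base x, 0), Or.inl rfl⟩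

/-- `E.Extends L F`: the space `F` arises from `E` by attaching successively, for each member `A`
of the list `L`, an admissible set of isolated points that accumulates exactly at (all points added
to `X` so far) `∪ A`. -/
inductive Extends [TopologicalSpace X] : SpaceOver X → List (Set X) → SpaceOver X → Prop
  | nil (E : SpaceOver X) : Extends E [] E
  | cons (E F : SpaceOver X) (A : Set X) (L : List (Set X)) (D : Set (E.carrier × I))
      (hD : IsAdmissible (E.added ∪ E.base '' A) D) (hF : Extends (E.attach D) L F) :
      Extends E (A :: L) F

/-- `E` is a coding space `I(X, S₁, …, Sₖ) = I_{2ᵏ - 1}(X, A₁, …, A_{2ᵏ - 1})`, where the `Aᵢ` are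
the increasing sequence attached to the `Sᵢ`, for some choice of the admissible sets. -/
def IsCodingSpace [TopologicalSpace X] (S : List (Set X)) (E : SpaceOver X) : Prop :=
  (self X).Extends (increasingSeq S) E

end SpaceOver

/-- The relation on `Z × [0, 1]` that identifies all points with second coordinate `1`. -/
def fanSetoid (Z : Type u) : Setoid (Z × I) where
  r p q := p = q ∨ (p.2 = 1 ∧ q.2 = 1)
  iseqv :=
    { refl := fun _ => Or.inl rfl
      symm := by
        rintro p q (h | h)
        · exact Or.inl h.symm
        · exact Or.inr h.symm
      trans := by
        rintro p q r (rfl | h) (rfl | h')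
        · exact Or.inl rfl
        · exact Or.inr h'
        · exact Or.inr h
        · exact Or.inr ⟨h.1, h'.2⟩ }

/-- The fan space of `Z`, with the quotient topology. -/
abbrev Fan (Z : Type u) : Type u := Quotient (fanSetoid Z)

/-- `F(Z, A)`: the subspace of the fan space of `Z` consisting of the classes of the `(x, s)` with
`s = 0` or `x ∈ A`. -/
def fanOver (Z : Type u) (A : Set Z) : Set (Fan Z) :=
  Quotient.mk (fanSetoid Z) '' {p | p.2 = 0 ∨ p.1 ∈ A}

/-- The connected coding space `J(X, S) = F(I(X, S), closure D)` built on a coding space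
`E = I(X, S) = X ∪ D`. -/
abbrev SpaceOver.ConnectedCode {X : Type u} (E : SpaceOver X) : Type u :=
  fanOver E.carrier (closure E.added)

/-! Admissible sets, and hence coding spaces, exist. -/

theorem exists_isAdmissible {Z : Type u} [TopologicalSpace Z] [CompactSpace Z]
    [TopologicalSpace.MetrizableSpace Z] [Nonempty Z] {A : Set Z} (hA : IsClosed A) :
    ∃ D, IsAdmissible A D := by
  rcases A.eq_empty_or_nonempty with rfl | hne
  · obtain ⟨z⟩ := ‹Nonempty Z›
    refine ⟨{(z, 1)}, ⟨?_, ⟨_, rfl⟩, ?_, ?_, fun _ => ⟨_, rfl⟩⟩⟩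
    · rintro p rfl
      exact zero_lt_one
    · rintro p rfl
      refine ⟨{q | 0 < q.2}, isOpen_lt continuous_const continuous_snd, ?_⟩
      ext q
      constructor
      · rintro ⟨h, h' | h'⟩
        · exact absurd h' (ne_of_gt h)
        · exact h'
      · rintro rfl
        exact ⟨(zero_lt_one : (0 : I) < 1), Or.inr rfl⟩
    · rw [isClosed_singleton.closure_eq]
      simp
  · let _ := TopologicalSpace.metrizableSpaceMetric Z
    have : Nonempty A := hne.to_subtype
    let d : ℕ → A := TopologicalSpace.denseSeq A
    let t : ℕ → I := fun n => ⟨1 / ((n : ℝ) + 1), by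
      constructor
      · positivity
      · rw [div_le_one (by positivity)]
        linarith [(Nat.cast_nonneg n : (0 : ℝ) ≤ n)]⟩
    have ht_pos : ∀ n, 0 < t n := fun n => by
      rw [← Subtype.coe_lt_coe]
      change (0 : ℝ) < 1 / ((n : ℝ) + 1)
      positivity
    have ht_lim : Filter.Tendsto t Filter.atTop (𝓝 0) := by
      rw [tendsto_subtype_rng]
      exact tendsto_one_div_add_atTop_nhds_zero_nat
    let f : ℕ → Z × I := fun n => (((d n.unpair.1 : A) : Z), t n)
    have hfin : ∀ p : Z × I, 0 < p.2 →
        ∃ U : Set (Z × I), IsOpen U ∧ p ∈ U ∧ (U ∩ range f).Finite := by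
      intro p hp
      obtain ⟨s, hs0, hsp⟩ := exists_between hp
      refine ⟨{q | s < q.2}, isOpen_lt continuous_const continuous_snd, hsp, ?_⟩
      have hev : ∀ᶠ n in Filter.atTop, t n < s := ht_lim.eventually (gt_mem_nhds hs0)
      obtain ⟨N, hN⟩ := Filter.eventually_atTop.1 hev
      refine ((Set.finite_lt_nat N).image f).subset ?_
      rintro q ⟨hq, n, rfl⟩
      refine ⟨n, ?_, rfl⟩
      by_contra h
      exact lt_asymm (hN n (not_lt.1 h)) hq
    refine ⟨range f, ⟨?_, ⟨_, 0, rfl⟩, ?_, ?_, fun h => absurd h hne.ne_empty⟩⟩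
    · rintro _ ⟨n, rfl⟩
      exact ht_pos n
    · rintro _ ⟨n, rfl⟩
      obtain ⟨U, hU, hpU, hf⟩ := hfin (f n) (ht_pos n)
      refine ⟨(U ∩ {q | 0 < q.2}) \ ((U ∩ range f) \ {f n}),
        (hU.inter (isOpen_lt continuous_const continuous_snd)).sdiff
          (hf.subset sdiff_subset).isClosed, ?_⟩
      ext q
      constructor
      · rintro ⟨⟨⟨hq, hq0⟩, hqn⟩, h' | h'⟩
        · exact absurd h' (ne_of_gt hq0)
        · by_contra hne'
          exact hqn ⟨⟨hq, h'⟩, hne'⟩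
      · rintro rfl
        exact ⟨⟨⟨hpU, ht_pos n⟩, fun h => h.2 rfl⟩, Or.inr ⟨n, rfl⟩⟩
    · ext p
      constructor
      · rintro ⟨hp, hpD⟩
        constructor
        · have hsub : closure (range f) ⊆ Prod.fst ⁻¹' A := by
            refine closure_minimal ?_ (hA.preimage continuous_fst)
            rintro _ ⟨n, rfl⟩
            exact (d _).2
          exact hsub hp
        · by_contra h0
          obtain ⟨U, hU, hpU, hf⟩ := hfin p (unitInterval.pos_iff_ne_zero.2 h0)
          have : p ∈ closure (U ∩ range f) := hU.inter_closure ⟨hpU, hp⟩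
          rw [hf.isClosed.closure_eq] at this
          exact hpD this.2
      · rcases p with ⟨a, s⟩
        rintro ⟨ha, hs⟩
        obtain rfl : s = 0 := hs
        refine ⟨?_, ?_⟩
        · have h1 : ∀ i, (((d i : A) : Z), (0 : I)) ∈ closure (range f) := by
            intro i
            have hpair : Filter.Tendsto (fun m => Nat.pair i m) Filter.atTop Filter.atTop :=
              Filter.tendsto_atTop_mono (fun m => Nat.right_le_pair i m) Filter.tendsto_id
            have hl : Filter.Tendsto (fun m => (((d i : A) : Z), t (Nat.pair i m)))
                Filter.atTop (𝓝 (((d i : A) : Z), (0 : I))) :=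
              tendsto_const_nhds.prodMk_nhds (ht_lim.comp hpair)
            refine mem_closure_of_tendsto hl (Filter.Eventually.of_forall fun m => ?_)
            refine ⟨Nat.pair i m, ?_⟩
            simp [f]
          have hcl : IsClosed {x : A | ((x : Z), (0 : I)) ∈ closure (range f)} :=
            isClosed_closure.preimage (continuous_subtype_val.prodMk continuous_const)
          have huniv : closure (range d) ⊆ {x : A | ((x : Z), (0 : I)) ∈ closure (range f)} :=
            closure_minimal (by rintro _ ⟨i, rfl⟩; exact h1 i) hcl
          exact huniv (TopologicalSpace.denseRange_denseSeq A ⟨a, ha⟩)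
        · rintro ⟨n, hn⟩
          exact (ht_pos n).ne' (congrArg Prod.snd hn)

theorem isClosed_codeSet {Z : Type u} [TopologicalSpace Z] {A : Set Z} {D : Set (Z × I)}
    (hD : IsAdmissible A D) : IsClosed (codeSet D) := by
  refine isClosed_of_closure_subset ?_
  intro p hp
  rw [codeSet, closure_union] at hp
  rcases hp with hp | hp
  · rw [(isClosed_eq continuous_snd continuous_const : IsClosed {p : Z × I | p.2 = 0}).closure_eq]
      at hp
    exact Or.inl hp
  · by_cases h : p ∈ D
    · exact Or.inr h
    · have : p ∈ closure D \ D := ⟨hp, h⟩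
      rw [hD.closure_diff] at this
      exact Or.inl this.2

theorem SpaceOver.exists_extends {X : Type u} [TopologicalSpace X] [CompactSpace X] [Nonempty X]
    (L : List (Set X)) : ∀ (E : SpaceOver X) (A₀ : Set X), CompactSpace E.carrier →
    TopologicalSpace.MetrizableSpace E.carrier → Continuous E.base →
    closure E.added ⊆ E.added ∪ E.base '' A₀ → (A₀ :: L).Pairwise (fun A B => A ⊆ B) →
    (∀ A ∈ L, IsClosed A) → ∃ F, E.Extends L F := by
  induction L with
  | nil => exact fun E _ _ _ _ _ _ _ => ⟨E, .nil E⟩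
  | cons A L ih =>
    intro E A₀ hc hm hb hcl hpw hL
    have hA₀ : A₀ ⊆ A := (List.pairwise_cons.1 hpw).1 A (by simp)
    have hcl' : closure E.added ⊆ E.added ∪ E.base '' A :=
      hcl.trans (union_subset_union_right _ (image_mono hA₀))
    have hclosed : IsClosed (E.added ∪ E.base '' A) := by
      refine isClosed_of_closure_subset ?_
      rw [closure_union, ((hL A (by simp)).isCompact.image hb).isClosed.closure_eq]
      exact union_subset hcl' subset_union_right
    have : Nonempty E.carrier := ‹Nonempty X›.map E.base
    obtain ⟨D, hD⟩ := exists_isAdmissible hclosed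
    have hb' : Continuous (E.attach D).base :=
      Continuous.subtype_mk (hb.prodMk continuous_const) _
    have hc' : CompactSpace (E.attach D).carrier :=
      isCompact_iff_compactSpace.1 (isClosed_codeSet hD).isCompact
    have hm' : TopologicalSpace.MetrizableSpace (E.attach D).carrier :=
      inferInstanceAs (TopologicalSpace.MetrizableSpace (codeSet D))
    obtain ⟨F, hF⟩ := ih (E.attach D) A hc' hm' hb' (by
      intro p hp
      by_cases hpa : p ∈ (E.attach D).added
      · exact Or.inl hpa
      · right
        obtain ⟨x, rfl⟩ := not_not.1 hpa
        have h1 : (E.base x, (0 : I)) ∈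
            closure (closure E.added ×ˢ {0} ∪ D) := by
          refine map_mem_closure (f := fun q : codeSet D => (q : E.carrier × I))
            continuous_subtype_val hp ?_
          rintro ⟨⟨z, s⟩, hq⟩ hqa
          rcases hq with hq | hq
          · obtain rfl : s = 0 := hq
            refine Or.inl ⟨subset_closure ?_, rfl⟩
            rintro ⟨y, rfl⟩
            exact hqa ⟨y, rfl⟩
          · exact Or.inr hq
        have h2 : E.base x ∈ E.added ∪ E.base '' A := by
          rw [closure_union, (isClosed_closure.prod isClosed_singleton).closure_eq] at h1
          rcases h1 with h1 | h1
          · exact hcl' h1.1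
          · by_cases h : (E.base x, (0 : I)) ∈ D
            · exact absurd (hD.pos _ h) (lt_irrefl _)
            · have : (E.base x, (0 : I)) ∈ closure D \ D := ⟨h1, h⟩
              rw [hD.closure_diff] at this
              exact this.1
        rcases h2 with h2 | ⟨a, ha, hax⟩
        · exact absurd ⟨x, rfl⟩ h2
        · exact ⟨a, ha, Subtype.ext (Prod.ext hax rfl)⟩)
      (List.pairwise_cons.1 hpw).2 (fun B hB => hL B (by simp [hB]))
    exact ⟨F, .cons E F A L D hD hF⟩

theorem increasingSeq_spec {X : Type u} [TopologicalSpace X] (S : List (Set X)) :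
    ∀ B : List (Set X), (∀ A ∈ S, IsClosed A) → (∀ A ∈ B, IsClosed A) →
    B.Pairwise (fun A B => A ⊆ B) →
    let R := S.foldl (fun B C => B.map (fun b => b ∩ C) ++ C :: B.map (fun b => b ∪ C)) B
    (∀ A ∈ R, IsClosed A) ∧ R.Pairwise (fun A B => A ⊆ B) := by
  induction S with
  | nil => exact fun B _ h h' => ⟨h, h'⟩
  | cons C S ih =>
    intro B hS hB hp
    have hC : IsClosed C := hS C (by simp)
    refine ih _ (fun A hA => hS A (by simp [hA])) ?_ ?_
    · intro A hA
      simp only [List.mem_append, List.mem_map, List.mem_cons] at hA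
      rcases hA with ⟨b, hb, rfl⟩ | rfl | ⟨b, hb, rfl⟩
      · exact (hB b hb).inter hC
      · exact hC
      · exact (hB b hb).union hC
    · rw [List.pairwise_append, List.pairwise_cons, List.pairwise_map, List.pairwise_map]
      refine ⟨hp.imp fun h => inter_subset_inter_left _ h, ⟨?_, hp.imp fun h =>
        union_subset_union_left _ h⟩, ?_⟩
      · intro A hA
        obtain ⟨b, _, rfl⟩ := List.mem_map.1 hA
        exact subset_union_right
      · intro A hA A' hA'
        obtain ⟨b, _, rfl⟩ := List.mem_map.1 hA
        rcases List.mem_cons.1 hA' with rfl | hA'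
        · exact inter_subset_right
        · obtain ⟨b', _, rfl⟩ := List.mem_map.1 hA'
          exact inter_subset_right.trans subset_union_right

theorem exists_isCodingSpace {X : Type u} [TopologicalSpace X] [CompactSpace X]
    [TopologicalSpace.MetrizableSpace X] [Nonempty X] (S : List (Set X))
    (hS : ∀ A ∈ S, IsClosed A) : ∃ E : SpaceOver X, E.IsCodingSpace S := by
  have h := increasingSeq_spec S [] hS (by simp) List.Pairwise.nil
  have hadd : (SpaceOver.self X).added = ∅ := by
    ext x
    exact iff_of_false (fun h => h ⟨x, rfl⟩) (fun h => h)
  refine SpaceOver.exists_extends (increasingSeq S) (SpaceOver.self X) ∅ ‹_› ‹_› continuous_id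
    ?_ (List.pairwise_cons.2 ⟨fun _ _ => empty_subset _, h.2⟩) h.1
  rw [hadd, closure_empty]
  exact empty_subset _

/-!
A homeomorphism `f : X → Y` that matches the sequences matches the increasing sequences attached to
them, and then extends over the coding spaces one layer at a time
(`SpaceOver.Extends.exists_homeomorph`). A single layer rests on `IsAdmissible.exists_homeomorph`:
the added points over homeomorphic pairs can be matched by a bijection for which partners lie over
closer and closer places. Such a bijection comes from two one-sided injections by the relational
form of the Schröder-Bernstein theorem, since closeness is measured by a symmetric relation.

For the converse, the connected coding space is a fan whose rays over the points added last, which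
are isolated and dense among all added points, are open in it (apart from the apex). If there are
infinitely many of them, the apex is the only point whose removal leaves infinitely many connected
pieces (`fanOver.exists_finite_cover`, `fanOver.not_hasFiniteComplement`); the absence of cut-points
in `X` enters here. The open components of the complement of the apex that accumulate at it are
exactly those rays (`fanOver.isBranch_iff`). Their endpoints accumulate at the bottom of the fan
part, and what is not a limit of such rays is the rest of `X`. So the coding space is recovered
topologically as the `spine` of the fan (`fanOver.spine_eq`). A homeomorphism of coding spaces maps
isolated points to isolated points; peeling off the layers it restricts to the base spaces, and the
sets of the increasing sequences are recovered as the accumulation points of the layers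
(`SpaceOver.exists_base_homeomorph`). Finally the increasing sequence determines the original one
(`forall₂_increasingSeq_iff`).

Only finitely many points are added last just when the increasing sequence is empty or consists of
the empty set alone. Then the fan is `X`, or the disjoint union of `X` and an arc, and `X` is the
union of the connected clopen sets without cut-points (`fanOver.uncutCore_eq`).
-/

/-! ### Recovering a sequence from its increasing sequence -/

theorem List.Forall₂.of_append {α β : Type*} {R : α → β → Prop} {a b : List α} {c d : List β}
    (h : List.Forall₂ R (a ++ b) (c ++ d)) (hl : a.length = c.length) :
    List.Forall₂ R a c ∧ List.Forall₂ R b d := by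
  induction a generalizing c with
  | nil =>
    obtain rfl : c = [] := List.length_eq_zero_iff.1 hl.symm
    exact ⟨.nil, h⟩
  | cons x a ih =>
    cases c with
    | nil => simp at hl
    | cons y c =>
      cases h with
      | cons hxy h =>
        obtain ⟨h₁, h₂⟩ := ih h (by simpa using hl)
        exact ⟨.cons hxy h₁, h₂⟩

theorem increasingSeq_concat {X : Type u} (S : List (Set X)) (C : Set X) :
    increasingSeq (S ++ [C]) =
      (increasingSeq S).map (fun b => b ∩ C) ++ C :: (increasingSeq S).map (fun b => b ∪ C) := by
  simp [increasingSeq, List.foldl_append]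

theorem length_increasingSeq_concat {X : Type u} (S : List (Set X)) (C : Set X) :
    (increasingSeq (S ++ [C])).length = 2 * (increasingSeq S).length + 1 := by
  rw [increasingSeq_concat, List.length_append, List.length_cons, List.length_map, List.length_map]
  omega

theorem mem_of_mem_increasingSeq {X : Type u} {x : X} (S : List (Set X)) (h : ∀ A ∈ S, x ∈ A) :
    ∀ A ∈ increasingSeq S, x ∈ A := by
  induction S using List.reverseRecOn with
  | nil => simp [increasingSeq]
  | append_singleton S C ih =>
    have hC : x ∈ C := h C (by simp)
    have ih' := ih fun A hA => h A (by simp [hA])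
    intro A hA
    simp only [increasingSeq_concat, List.mem_append, List.mem_map, List.mem_cons] at hA
    rcases hA with ⟨b, hb, rfl⟩ | rfl | ⟨b, hb, rfl⟩
    · exact ⟨ih' b hb, hC⟩
    · exact hC
    · exact Or.inr hC

/-- A bijection matches two sequences if and only if it matches the associated increasing
sequences: the last set is the middle term, and each earlier term `b` is determined by `b ∩ C` and
`b ∪ C`. -/
theorem forall₂_increasingSeq_iff {X : Type u} {Y : Type v} (f : X ≃ Y) (S : List (Set X)) :
    ∀ T : List (Set Y),
      List.Forall₂ (fun A B => f '' A = B) (increasingSeq S) (increasingSeq T) ↔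
        List.Forall₂ (fun A B => f '' A = B) S T := by
  induction S using List.reverseRecOn with
  | nil =>
    intro T
    induction T using List.reverseRecOn with
    | nil => simp [increasingSeq]
    | append_singleton T C =>
      refine iff_of_false (fun h => ?_) (fun h => by simpa using h.length_eq)
      have := h.length_eq
      rw [length_increasingSeq_concat] at this
      simp [increasingSeq] at this
  | append_singleton S C ih =>
    intro T
    induction T using List.reverseRecOn with
    | nil =>
      refine iff_of_false (fun h => ?_) (fun h => by simpa using h.length_eq)
      have := h.length_eq
      rw [length_increasingSeq_concat] at this
      simp [increasingSeq] at this
    | append_singleton T C' =>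
      constructor
      · intro h
        have hl : (increasingSeq S).length = (increasingSeq T).length := by
          have := h.length_eq
          rw [length_increasingSeq_concat, length_increasingSeq_concat] at this
          omega
        rw [increasingSeq_concat, increasingSeq_concat] at h
        obtain ⟨h₁, h₂⟩ := h.of_append (by simpa using hl)
        obtain ⟨hC, h₂⟩ := List.forall₂_cons.1 h₂
        rw [List.forall₂_map_left_iff, List.forall₂_map_right_iff] at h₁ h₂
        refine List.rel_append ((ih T).1 (List.Forall₂.mp ?_ h₁ h₂)) (.cons hC .nil)
        intro b b' hi hu
        rw [image_inter f.injective, hC] at hi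
        rw [image_union, hC] at hu
        exact eq_of_inf_eq_sup_eq hi hu
      · intro h
        have hl : S.length = T.length := by simpa using h.length_eq
        obtain ⟨h₁, h₂⟩ := h.of_append hl
        obtain ⟨hC, -⟩ := List.forall₂_cons.1 h₂
        rw [increasingSeq_concat, increasingSeq_concat]
        refine List.rel_append ?_ (.cons hC ?_) <;>
        · rw [List.forall₂_map_left_iff, List.forall₂_map_right_iff]
          refine ((ih T).2 h₁).imp fun b b' hb => ?_
          simp only [image_inter f.injective, image_union, hC, hb]

/-! ### Uniqueness of the space with added isolated points -/

/-- Infinite sets indexed by a countable type have distinct representatives. -/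
theorem exists_injective_of_infinite {ι α : Type*} [Countable ι] (S : ι → Set α)
    (hS : ∀ i, (S i).Infinite) : ∃ f : ι → α, Function.Injective f ∧ ∀ i, f i ∈ S i := by
  classical
  obtain ⟨e, he⟩ := exists_injective_nat ι
  choose t ht hc using fun i => (hS i).exists_subset_card_eq (e i + 1)
  obtain ⟨f, hf, hft⟩ := (Finset.all_card_le_biUnion_card_iff_exists_injective t).1 (by
    intro s
    rcases s.eq_empty_or_nonempty with rfl | hs
    · simp
    obtain ⟨i, hi, hmax⟩ := s.exists_max_image e hs
    calc s.card = (s.image e).card := (Finset.card_image_of_injective s he).symm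
      _ ≤ (Finset.range (e i + 1)).card := Finset.card_le_card fun n hn => by
          obtain ⟨j, hj, rfl⟩ := Finset.mem_image.1 hn
          exact Finset.mem_range.2 (Nat.lt_succ_of_le (hmax j hj))
      _ = (t i).card := by rw [Finset.card_range, hc]
      _ ≤ _ := Finset.card_le_card (Finset.subset_biUnion_of_mem t hi))
  exact ⟨f, hf, fun i => ht i (hft i)⟩

/-- The copy of `Z` inside the space `Z × {0} ∪ D`. -/
def zeroPoint {Z : Type u} (D : Set (Z × I)) (z : Z) : codeSet D :=
  ⟨(z, 0), Or.inl rfl⟩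

theorem continuous_zeroPoint {Z : Type u} [TopologicalSpace Z] (D : Set (Z × I)) :
    Continuous (zeroPoint D) :=
  (continuous_id.prodMk continuous_const).subtype_mk _

theorem zeroPoint_injective {Z : Type u} (D : Set (Z × I)) : Function.Injective (zeroPoint D) :=
  fun _ _ h => congrArg (fun p : codeSet D => (p : Z × I).1) h

theorem eq_zeroPoint {Z : Type u} {D : Set (Z × I)} {p : codeSet D} (hp : (p : Z × I).2 = 0) :
    p = zeroPoint D (p : Z × I).1 :=
  Subtype.ext (Prod.ext rfl hp)

namespace IsAdmissible

variable {Z : Type u} [TopologicalSpace Z] {A : Set Z} {D : Set (Z × I)}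

theorem zero_notMem (hD : IsAdmissible A D) (z : Z) : (z, (0 : I)) ∉ D :=
  fun h => lt_irrefl _ (hD.pos _ h)

theorem isOpen_singleton_of_mem (hD : IsAdmissible A D) {p : codeSet D} (hp : (p : Z × I) ∈ D) :
    IsOpen ({p} : Set (codeSet D)) := by
  obtain ⟨U, hU, h⟩ := hD.isolated p hp
  refine ⟨U, hU, ?_⟩
  ext q
  constructor
  · intro hq
    have : (q : Z × I) ∈ U ∩ codeSet D := ⟨hq, q.2⟩
    rw [h] at this
    exact Subtype.ext this
  · rintro rfl
    exact (h.ge rfl : (q : Z × I) ∈ U ∩ codeSet D).1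

theorem zero_mem_closure_iff (hD : IsAdmissible A D) {z : Z} :
    (z, (0 : I)) ∈ closure D ↔ z ∈ A := by
  have := Set.ext_iff.1 hD.closure_diff (z, 0)
  simpa [hD.zero_notMem] using this

/-- The added points accumulate at `A × {0}` only. -/
theorem finite_diff [CompactSpace Z] (hD : IsAdmissible A D) {W : Set (Z × I)} (hW : IsOpen W)
    (hAW : A ×ˢ {0} ⊆ W) : (D \ W).Finite := by
  have hK : IsCompact (closure D \ W) := (isClosed_closure.sdiff hW).isCompact
  have hKD : closure D \ W ⊆ D := by
    intro p hp
    by_contra h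
    exact hp.2 (hAW (hD.closure_diff.le ⟨hp.1, h⟩))
  choose! U hU hUp using hD.isolated
  obtain ⟨t, htK, ht⟩ := hK.elim_nhds_subcover U (fun p hp =>
    (hU p (hKD hp)).mem_nhds ((hUp p (hKD hp)).ge rfl).1)
  refine t.finite_toSet.subset fun p hp => ?_
  obtain ⟨q, hq, hpq⟩ := mem_iUnion₂.1
    (ht (show p ∈ closure D \ W from ⟨subset_closure hp.1, hp.2⟩))
  have : p ∈ U q ∩ codeSet D := ⟨hpq, Or.inr hp.1⟩
  rw [hUp _ (hKD (htK q hq))] at this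
  exact (mem_singleton_iff.1 this) ▸ hq

theorem tendsto_cofinite [CompactSpace Z] (hD : IsAdmissible A D) {g : Z × I → ℝ}
    (hg : Continuous g) (hg0 : ∀ p, 0 ≤ g p) (hgA : ∀ a ∈ A, g (a, 0) = 0) :
    Filter.Tendsto (fun d : D => g d) Filter.cofinite (𝓝 0) := by
  refine tendsto_order.2 ⟨fun ε hε => .of_forall fun d => hε.trans_le (hg0 _), fun ε hε => ?_⟩
  have hW : IsOpen {p | g p < ε} := isOpen_lt hg continuous_const
  have := hD.finite_diff hW (by
    rintro ⟨a, s⟩ ⟨ha, hs⟩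
    obtain rfl : s = 0 := hs
    exact (hgA a ha).trans_lt hε)
  refine (this.preimage Subtype.val_injective.injOn).subset fun d hd => ⟨d.2, hd⟩

theorem tendsto_height [CompactSpace Z] (hD : IsAdmissible A D) :
    Filter.Tendsto (fun d : D => ((d : Z × I).2 : ℝ)) Filter.cofinite (𝓝 0) :=
  hD.tendsto_cofinite (g := fun p => (p.2 : ℝ)) (by fun_prop) (fun p => p.2.2.1) (fun _ _ => rfl)

theorem countable [CompactSpace Z] (hD : IsAdmissible A D) : Countable D := by
  rw [← countable_univ_iff]
  convert hD.tendsto_height.countable_compl_preimage_ker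
  symm
  refine eq_univ_of_forall fun d => ?_
  simpa using fun h : (d : Z × I).2 = 0 => (hD.pos _ d.2).ne' h

theorem infinite_of_mem_nhds [T1Space Z] (hD : IsAdmissible A D) {a : Z} (ha : a ∈ A)
    {W : Set (Z × I)} (hW : W ∈ 𝓝 (a, (0 : I))) : {d : D | (d : Z × I) ∈ W}.Infinite := by
  intro hf
  have h0 : (a, (0 : I)) ∈ closure D := hD.zero_mem_closure_iff.2 ha
  have hf' : (W ∩ D).Finite := by
    refine (hf.image Subtype.val).subset ?_
    rintro p ⟨hp, hpD⟩
    exact ⟨⟨p, hpD⟩, hp, rfl⟩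
  have h1 : (a, (0 : I)) ∈ closure (W ∩ D) := by
    rw [mem_closure_iff_nhds] at h0 ⊢
    intro t ht
    obtain ⟨p, ⟨h1, h2⟩, h3⟩ := h0 _ (Filter.inter_mem ht hW)
    exact ⟨p, h1, h2, h3⟩
  rw [hf'.isClosed.closure_eq] at h1
  exact hD.zero_notMem a h1.2

/-- One-sided matching: each member `i` of a countable family of points `m i` can be given its own
added point that lies over a place nearly as close to `m i` as `h '' A` is. -/
theorem exists_injective {ι : Type*} [Countable ι] {M : Type v} [MetricSpace M] [T1Space Z]
    (hD : IsAdmissible A D) (hA : A.Nonempty) {h : Z → M} (hh : Continuous h) (m : ι → M)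
    {r : ι → ℝ} (hr : ∀ i, 0 < r i) :
    ∃ f : ι → D, Function.Injective f ∧
      ∀ i, dist (m i) (h (f i : Z × I).1) < Metric.infDist (m i) (h '' A) + r i := by
  refine exists_injective_of_infinite (fun i => {d : D | dist (m i) (h (d : Z × I).1)
    < Metric.infDist (m i) (h '' A) + r i}) fun i => ?_
  obtain ⟨_, ⟨a, ha, rfl⟩, hia⟩ := (Metric.infDist_lt_iff (hA.image h)).1
    (lt_add_of_pos_right (Metric.infDist (m i) (h '' A)) (hr i))
  refine hD.infinite_of_mem_nhds ha (W := {p | dist (m i) (h p.1)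
    < Metric.infDist (m i) (h '' A) + r i}) (IsOpen.mem_nhds ?_ hia)
  exact isOpen_lt (by fun_prop) continuous_const

/-- The added points over two homeomorphic pairs can be matched in such a way that all but
finitely many pairs of partners lie over nearly the same place. -/
theorem exists_bijective {Z' : Type v} [MetricSpace Z'] [CompactSpace Z'] [CompactSpace Z]
    [T1Space Z] {A' : Set Z'} {D' : Set (Z' × I)} (hD : IsAdmissible A D)
    (hD' : IsAdmissible A' D') (h : Z ≃ₜ Z') (hA : h '' A = A') :
    ∃ f : D → D', Function.Bijective f ∧
      Filter.Tendsto (fun d : D => dist (h (d : Z × I).1) (f d : Z' × I).1)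
        Filter.cofinite (𝓝 0) := by
  rcases A.eq_empty_or_nonempty with rfl | hne
  · obtain ⟨p, rfl⟩ := hD.singleton_of_empty rfl
    obtain ⟨p', rfl⟩ := hD'.singleton_of_empty (by rw [← hA, image_empty])
    refine ⟨fun _ => default, ⟨fun _ _ _ => Subsingleton.elim _ _,
      fun d => ⟨default, Subsingleton.elim _ _⟩⟩, ?_⟩
    rw [Filter.cofinite_eq_bot]
    exact Filter.tendsto_bot
  have hne' : A'.Nonempty := hA ▸ hne.image h
  have := hD.countable
  have := hD'.countable
  obtain ⟨f, hf, hfd⟩ := hD'.exists_injective hne' continuous_id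
    (fun d : D => h (d : Z × I).1) (r := fun d => ((d : Z × I).2 : ℝ)) fun d => hD.pos _ d.2
  obtain ⟨g, hg, hgd⟩ := hD.exists_injective hne h.continuous
    (fun d : D' => (d : Z' × I).1) (r := fun d => ((d : Z' × I).2 : ℝ)) fun d => hD'.pos _ d.2
  simp only [image_id', hA, id] at hfd hgd
  obtain ⟨β, hβ, hβd⟩ := Function.Embedding.schroeder_bernstein_of_rel hf hg
    (fun d d' => dist (h (d : Z × I).1) (d' : Z' × I).1 <
      (Metric.infDist (h (d : Z × I).1) A' + ((d : Z × I).2 : ℝ)) +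
      (Metric.infDist (d' : Z' × I).1 A' + ((d' : Z' × I).2 : ℝ)))
    (fun d => (hfd d).trans_le
      (le_add_of_nonneg_right (add_nonneg Metric.infDist_nonneg (f d : Z' × I).2.2.1)))
    (fun d => (dist_comm _ _).trans_lt <| (hgd d).trans_le
      (le_add_of_nonneg_left (add_nonneg Metric.infDist_nonneg (g d : Z × I).2.2.1)))
  refine ⟨β, hβ, ?_⟩
  have h1 := hD.tendsto_cofinite
    (g := fun p => Metric.infDist (h p.1) A' + (p.2 : ℝ))
    (((Metric.continuous_infDist_pt A').comp (h.continuous.comp continuous_fst)).add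
      (by fun_prop)) (fun p => add_nonneg Metric.infDist_nonneg p.2.2.1)
    (fun a ha => by simp [Metric.infDist_zero_of_mem (hA.le ⟨a, ha, rfl⟩ : h a ∈ A')])
  have h2 := hD'.tendsto_cofinite
    (g := fun p => Metric.infDist p.1 A' + (p.2 : ℝ))
    (((Metric.continuous_infDist_pt A').comp continuous_fst).add
      (by fun_prop)) (fun p => add_nonneg Metric.infDist_nonneg p.2.2.1)
    (fun a ha => by simp [Metric.infDist_zero_of_mem ha])
  have h3 := h1.add (h2.comp hβ.injective.tendsto_cofinite)
  rw [add_zero] at h3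
  exact squeeze_zero (fun _ => dist_nonneg) (fun d => (hβd d).le) h3

/-- The space with added isolated points depends only on the pair: a homeomorphism of pairs
extends to the spaces with added points. -/
theorem exists_homeomorph {Z' : Type v} [MetricSpace Z'] [CompactSpace Z'] [CompactSpace Z]
    [T1Space Z] {A' : Set Z'} {D' : Set (Z' × I)} (hD : IsAdmissible A D)
    (hD' : IsAdmissible A' D') (h : Z ≃ₜ Z') (hA : h '' A = A') :
    ∃ H : codeSet D ≃ₜ codeSet D', ∀ z, H (zeroPoint D z) = zeroPoint D' (h z) := by
  classical
  obtain ⟨f, hf, hfd⟩ := hD.exists_bijective hD' h hA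
  let H : codeSet D → codeSet D' := fun p =>
    if hp : (p : Z × I) ∈ D then ⟨f ⟨p, hp⟩, Or.inr (f ⟨p, hp⟩).2⟩
    else ⟨(h (p : Z × I).1, 0), Or.inl rfl⟩
  have H0 : ∀ z, H (zeroPoint D z) = zeroPoint D' (h z) := fun z =>
    dif_neg (hD.zero_notMem z)
  have H1 : ∀ d : D, H ⟨d, Or.inr d.2⟩ = ⟨f d, Or.inr (f d).2⟩ := fun d => dif_pos d.2
  have hcases : ∀ p : codeSet D, (∃ z, p = zeroPoint D z) ∨ ∃ d : D, p = ⟨d, Or.inr d.2⟩ := by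
    rintro ⟨⟨z, s⟩, hs | hd⟩
    · obtain rfl : s = 0 := hs
      exact Or.inl ⟨z, rfl⟩
    · exact Or.inr ⟨⟨_, hd⟩, rfl⟩
  have hbij : Function.Bijective H := by
    constructor
    · intro p q hpq
      obtain ⟨z, rfl⟩ | ⟨d, rfl⟩ := hcases p <;> obtain ⟨w, rfl⟩ | ⟨e, rfl⟩ := hcases q
      · rw [H0, H0] at hpq
        have := h.injective (congrArg (fun r : codeSet D' => (r : Z' × I).1) hpq)
        rw [this]
      · rw [H0, H1] at hpq
        have : (h z, 0) = (f e : Z' × I) := congrArg Subtype.val hpq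
        exact absurd (this ▸ (f e).2) (hD'.zero_notMem _)
      · rw [H0, H1] at hpq
        have : (f d : Z' × I) = (h w, 0) := congrArg Subtype.val hpq
        exact absurd (this ▸ (f d).2) (hD'.zero_notMem _)
      · rw [H1, H1] at hpq
        have := hf.injective (Subtype.ext (Subtype.mk.inj hpq))
        rw [this]
    · rintro ⟨⟨z, s⟩, hs | hd⟩
      · obtain rfl : s = 0 := hs
        exact ⟨zeroPoint D (h.symm z), by rw [H0, h.apply_symm_apply]; rfl⟩
      · obtain ⟨d, hd'⟩ := hf.surjective ⟨_, hd⟩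
        exact ⟨⟨d, Or.inr d.2⟩, by rw [H1]; simp [hd']⟩
  have hcont : Continuous H := by
    rw [continuous_iff_continuousAt]
    intro p
    obtain ⟨z, rfl⟩ | ⟨d, rfl⟩ := hcases p
    · have hsmall : Filter.Tendsto (fun q : codeSet D =>
          dist (h (q : Z × I).1) (H q : Z' × I).1 + ((H q : Z' × I).2 : ℝ))
          (𝓝 (zeroPoint D z)) (𝓝 0) := by
        have hlim : Filter.Tendsto (fun d : D => dist (h (d : Z × I).1) (f d : Z' × I).1 +
            ((f d : Z' × I).2 : ℝ)) Filter.cofinite (𝓝 0) := by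
          simpa using hfd.add (hD'.tendsto_height.comp hf.injective.tendsto_cofinite)
        refine tendsto_order.2 ⟨fun ε hε => .of_forall fun q =>
          hε.trans_le (add_nonneg dist_nonneg (H q : Z' × I).2.2.1), fun ε hε => ?_⟩
        have hfin := (hlim.eventually (gt_mem_nhds hε))
        rw [Filter.eventually_cofinite] at hfin
        have hfin' := hfin.image (fun d : D => (⟨d, Or.inr d.2⟩ : codeSet D))
        filter_upwards [hfin'.isClosed.isOpen_compl.mem_nhds (by
          rintro ⟨d, -, hd⟩
          have : (d : Z × I) = (z, 0) := congrArg Subtype.val hd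
          exact hD.zero_notMem z (this ▸ d.2))] with q hq
        obtain ⟨w, rfl⟩ | ⟨d, rfl⟩ := hcases q
        · rw [H0]
          simpa [zeroPoint] using hε
        · rw [H1]
          by_contra hcon
          exact hq ⟨d, hcon, rfl⟩
      have hd : Filter.Tendsto (fun q : codeSet D =>
          dist (h (q : Z × I).1) (H q : Z' × I).1) (𝓝 (zeroPoint D z)) (𝓝 0) :=
        squeeze_zero (fun _ => dist_nonneg)
          (fun q => le_add_of_nonneg_right (H q : Z' × I).2.2.1) hsmall
      have hs : Filter.Tendsto (fun q : codeSet D =>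
          ((H q : Z' × I).2 : ℝ)) (𝓝 (zeroPoint D z)) (𝓝 0) :=
        squeeze_zero (fun q => (H q : Z' × I).2.2.1)
          (fun q => le_add_of_nonneg_left dist_nonneg) hsmall
      rw [ContinuousAt, H0, tendsto_subtype_rng, Prod.tendsto_iff]
      refine ⟨?_, tendsto_subtype_rng.2 hs⟩
      have hc : Filter.Tendsto (fun q : codeSet D => h (q : Z × I).1) (𝓝 (zeroPoint D z))
          (𝓝 (h z)) :=
        (h.continuous.comp (continuous_fst.comp continuous_subtype_val)).tendsto _
      exact (tendsto_iff_of_dist hd).1 hc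
    · rw [ContinuousAt, (isOpen_singleton_iff_nhds_eq_pure _).1
        (hD.isOpen_singleton_of_mem (p := ⟨d, Or.inr d.2⟩) d.2)]
      exact tendsto_pure_nhds _ _
  have : CompactSpace (codeSet D) := isCompact_iff_compactSpace.1 (isClosed_codeSet hD).isCompact
  exact ⟨hcont.homeoOfEquivCompactToT2 (f := Equiv.ofBijective H hbij), H0⟩

end IsAdmissible

/-! ### Structure of the coding spaces -/

namespace SpaceOver

variable {X : Type u} {Y : Type v}

theorem image_added {E : SpaceOver X} {E' : SpaceOver Y} {f : X ≃ Y}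
    {h : E.carrier ≃ E'.carrier} (hf : ∀ x, h (E.base x) = E'.base (f x)) :
    h '' E.added = E'.added := by
  have : h '' range E.base = range E'.base := by
    rw [← range_comp, show h ∘ E.base = E'.base ∘ f from funext hf, f.surjective.range_comp]
  rw [added, added, image_compl_eq h.bijective, this]

section attach

variable {G : SpaceOver X} {A : Set X} {D : Set (G.carrier × I)}

theorem mem_added_attach_of_mem {p : codeSet D} (hD : IsAdmissible (G.added ∪ G.base '' A) D)
    (hp : (p : G.carrier × I) ∈ D) : p ∈ (G.attach D).added := by
  rintro ⟨x, rfl⟩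
  exact hD.zero_notMem _ hp

theorem mem_closure_attach_iff (hD : IsAdmissible (G.added ∪ G.base '' A) D) (z : G.carrier) :
    zeroPoint D z ∈ closure {p : codeSet D | (p : G.carrier × I) ∈ D} ↔
      z ∈ G.added ∪ G.base '' A := by
  have : Subtype.val '' {p : codeSet D | (p : G.carrier × I) ∈ D} = D := by
    ext p
    exact ⟨by rintro ⟨q, hq, rfl⟩; exact hq, fun hp => ⟨⟨p, Or.inr hp⟩, hp, rfl⟩⟩
  rw [closure_subtype, this, ← hD.zero_mem_closure_iff]
  rfl

/-- The points added last are dense among all added points. -/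
theorem closure_added_attach (hD : IsAdmissible (G.added ∪ G.base '' A) D) :
    closure (G.attach D).added = closure {p : codeSet D | (p : G.carrier × I) ∈ D} := by
  refine subset_antisymm (closure_minimal ?_ isClosed_closure)
    (closure_mono fun p hp => mem_added_attach_of_mem hD hp)
  rintro ⟨⟨z, s⟩, hs | hd⟩ hp
  · obtain rfl : s = 0 := hs
    refine (mem_closure_attach_iff hD z).2 (Or.inl ?_)
    rintro ⟨x, rfl⟩
    exact hp ⟨x, rfl⟩
  · exact subset_closure hd

end attach

variable [TopologicalSpace X] [TopologicalSpace Y]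

/-- A compact metrizable space containing a continuous injective copy of `X`. All coding spaces
over a compact metrizable `X` are of this kind. -/
structure IsCompactOver (E : SpaceOver X) : Prop where
  compact : CompactSpace E.carrier
  metrizable : TopologicalSpace.MetrizableSpace E.carrier
  continuous_base : Continuous E.base
  injective_base : Function.Injective E.base

theorem isCompactOver_self [CompactSpace X] [TopologicalSpace.MetrizableSpace X] :
    (self X).IsCompactOver :=
  ⟨‹_›, ‹_›, continuous_id, Function.injective_id⟩

theorem IsCompactOver.attach {E : SpaceOver X} (hE : E.IsCompactOver) {A : Set E.carrier}
    {D : Set (E.carrier × I)} (hD : IsAdmissible A D) : (E.attach D).IsCompactOver := by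
  have := hE.compact
  have := hE.metrizable
  refine ⟨isCompact_iff_compactSpace.1 (isClosed_codeSet hD).isCompact,
    inferInstanceAs (TopologicalSpace.MetrizableSpace (codeSet D)),
    Continuous.subtype_mk (hE.continuous_base.prodMk continuous_const) _, fun x y h => ?_⟩
  exact hE.injective_base (congrArg (fun p : codeSet D => (p : E.carrier × I).1) h)

theorem Extends.isCompactOver {E F : SpaceOver X} {L : List (Set X)} (h : E.Extends L F)
    (hE : E.IsCompactOver) : F.IsCompactOver := by
  induction h with
  | nil E => exact hE
  | cons E F A L D hD hF ih => exact ih (hE.attach hD)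

theorem Extends.exists_of_concat {L : List (Set X)} {A : Set X} {F : SpaceOver X} :
    ∀ {E : SpaceOver X}, E.Extends (L ++ [A]) F → ∃ (G : SpaceOver X) (D : Set (G.carrier × I)),
      E.Extends L G ∧ IsAdmissible (G.added ∪ G.base '' A) D ∧ F = G.attach D := by
  induction L with
  | nil =>
    rintro E (_ | ⟨_, _, _, _, D, hD, _ | _⟩)
    exact ⟨E, D, .nil E, hD, rfl⟩
  | cons B L ih =>
    rintro E (_ | ⟨_, _, _, _, D, hD, hF⟩)
    obtain ⟨G, D', hG, hD', h⟩ := ih hF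
    exact ⟨G, D', .cons _ _ _ _ D hD hG, hD', h⟩

/-- The coding spaces of matching sequences over homeomorphic spaces are homeomorphic, whatever the
choices of the admissible sets. -/
theorem Extends.exists_homeomorph (f : X ≃ₜ Y) {E F : SpaceOver X} {L : List (Set X)}
    (hF : E.Extends L F) : ∀ {E' F' : SpaceOver Y} {L' : List (Set Y)}, E'.Extends L' F' →
      List.Forall₂ (fun A B => f '' A = B) L L' → E.IsCompactOver → E'.IsCompactOver →
      ∀ h : E.carrier ≃ₜ E'.carrier, (∀ x, h (E.base x) = E'.base (f x)) →
      ∃ H : F.carrier ≃ₜ F'.carrier, ∀ x, H (F.base x) = F'.base (f x) := by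
  induction hF with
  | nil E =>
    intro E' F' L' hF' hL _ _ h hf
    cases hL
    cases hF'
    exact ⟨h, hf⟩
  | cons E F A L D hD hF ih =>
    intro E' F' L' hF' hL hE hE' h hf
    cases hL with
    | cons hAB hL =>
      cases hF' with
      | cons _ _ B L' D' hD' hF' =>
        have := hE.compact
        have := hE'.compact
        have := hE.metrizable
        have := hE'.metrizable
        let _ := TopologicalSpace.metrizableSpaceMetric E'.carrier
        obtain ⟨H, hH⟩ := hD.exists_homeomorph hD' h (by
          rw [image_union]
          congr 1
          · exact image_added (f := f.toEquiv) (h := h.toEquiv) hf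
          · rw [← hAB, image_image, image_image]
            exact image_congr fun x _ => hf x)
        refine ih hF' hL (hE.attach hD) (hE'.attach hD') H fun x => ?_
        refine (hH (E.base x)).trans ?_
        rw [hf]
        rfl

section isolated

variable {G : SpaceOver X} {A : Set X} {D : Set (G.carrier × I)}

/-- Points of `G` where the new points accumulate are not isolated any more, and `A` contains the
isolated points of `X`, so exactly the new points are isolated. -/
theorem isOpen_singleton_attach_iff (hG : G.IsCompactOver)
    (hD : IsAdmissible (G.added ∪ G.base '' A) D) (hA : ∀ x : X, IsOpen {x} → x ∈ A)
    (p : codeSet D) : IsOpen ({p} : Set (codeSet D)) ↔ (p : G.carrier × I) ∈ D := by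
  have := hG.metrizable
  refine ⟨fun hp => ?_, hD.isOpen_singleton_of_mem⟩
  obtain ⟨⟨z, s⟩, hs | hd⟩ := p
  swap
  · exact hd
  obtain rfl : s = 0 := hs
  exfalso
  have hz : IsOpen ({z} : Set G.carrier) := by
    have := hp.preimage (continuous_zeroPoint D)
    have hz : ({zeroPoint D z} : Set (codeSet D)) = zeroPoint D '' {z} := image_singleton.symm
    change IsOpen (zeroPoint D ⁻¹' {zeroPoint D z}) at this
    rwa [hz, (zeroPoint_injective D).preimage_image] at this
  have hzA : z ∈ G.added ∪ G.base '' A := by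
    by_cases hza : z ∈ G.added
    · exact Or.inl hza
    · obtain ⟨x, rfl⟩ := not_not.1 hza
      refine Or.inr ⟨x, hA x ?_, rfl⟩
      have := hz.preimage hG.continuous_base
      rwa [← image_singleton, hG.injective_base.preimage_image] at this
  obtain ⟨W, hW, hWp⟩ := hp
  obtain ⟨d, hd⟩ := (hD.infinite_of_mem_nhds hzA
    (hW.mem_nhds (hWp.ge rfl : _ ∈ W))).nonempty
  have : (d : G.carrier × I) = (z, 0) :=
    congrArg Subtype.val (hWp.le hd : (⟨d, Or.inr d.2⟩ : codeSet D) = zeroPoint D z)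
  exact hD.zero_notMem z (this ▸ d.2)

theorem not_connectedSpace_attach [Nonempty X] (hG : G.IsCompactOver)
    (hD : IsAdmissible (G.added ∪ G.base '' A) D) : ¬ ConnectedSpace (codeSet D) := by
  intro hc
  have := hG.metrizable
  obtain ⟨p, hp⟩ := hD.nonempty
  have hclopen : IsClopen ({⟨p, Or.inr hp⟩} : Set (codeSet D)) :=
    ⟨isClosed_singleton, hD.isOpen_singleton_of_mem hp⟩
  rcases isClopen_iff.1 hclopen with h | h
  · exact (singleton_nonempty _).ne_empty h
  · obtain ⟨x⟩ := ‹Nonempty X›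
    have : (⟨(G.base x, 0), Or.inl rfl⟩ : codeSet D) = ⟨p, Or.inr hp⟩ := h.ge trivial
    exact hD.zero_notMem _ ((Subtype.mk.inj this : (G.base x, (0 : I)) = p) ▸ hp)

end isolated

/-- A homeomorphism between coding spaces carries the points added last, which are the isolated
points, to the points added last. Stripping them off repeatedly, it restricts to the base spaces,
and the sets of the sequence are the traces on the base of the accumulation points of each layer. -/
theorem exists_base_homeomorph [CompactSpace X] [TopologicalSpace.MetrizableSpace X]
    [ConnectedSpace X] [CompactSpace Y] [TopologicalSpace.MetrizableSpace Y] [ConnectedSpace Y]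
    (L : List (Set X)) :
    ∀ {L' : List (Set Y)} {E : SpaceOver X} {E' : SpaceOver Y},
      (self X).Extends L E → (self Y).Extends L' E' →
      (∀ A ∈ L, ∀ x : X, IsOpen {x} → x ∈ A) → (∀ B ∈ L', ∀ y : Y, IsOpen {y} → y ∈ B) →
      ∀ h : E.carrier ≃ₜ E'.carrier, ∃ f : X ≃ₜ Y, (∀ x, h (E.base x) = E'.base (f x)) ∧
        List.Forall₂ (fun A B => f '' A = B) L L' := by
  induction L using List.reverseRecOn with
  | nil =>
    intro L' E E' hE hE' _ _ h
    cases hE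
    induction L' using List.reverseRecOn with
    | nil =>
      cases hE'
      exact ⟨h, fun _ => rfl, .nil⟩
    | append_singleton L' B =>
      obtain ⟨G', D', hG', hD', rfl⟩ := hE'.exists_of_concat
      have : ConnectedSpace (self X).carrier := ‹ConnectedSpace X›
      exact absurd h.surjective.connectedSpace (fun H => not_connectedSpace_attach
        (hG'.isCompactOver isCompactOver_self) hD' (H h.continuous))
  | append_singleton L A ih =>
    intro L' E E' hE hE' hL hL' h
    obtain ⟨G, D, hG, hD, rfl⟩ := hE.exists_of_concat
    have hGc := hG.isCompactOver isCompactOver_self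
    induction L' using List.reverseRecOn with
    | nil =>
      cases hE'
      have : ConnectedSpace (self Y).carrier := ‹ConnectedSpace Y›
      exact absurd h.symm.surjective.connectedSpace (fun H => not_connectedSpace_attach
        hGc hD (H h.symm.continuous))
    | append_singleton L' B =>
      obtain ⟨G', D', hG', hD', rfl⟩ := hE'.exists_of_concat
      have hGc' := hG'.isCompactOver isCompactOver_self
      change codeSet D ≃ₜ codeSet D' at h
      have hA : ∀ x : X, IsOpen {x} → x ∈ A := hL A (by simp)
      have hB : ∀ y : Y, IsOpen {y} → y ∈ B := hL' B (by simp)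
      have hDD : ∀ p, (h p : G'.carrier × I) ∈ D' ↔ (p : G.carrier × I) ∈ D := by
        intro p
        rw [← isOpen_singleton_attach_iff hGc hD hA, ← isOpen_singleton_attach_iff hGc' hD' hB,
          ← image_singleton, h.isOpen_image]
      have hz : ∀ z, ((h (zeroPoint D z) : codeSet D') : G'.carrier × I).2 = 0 := fun z =>
        (h _).2.resolve_right fun H => hD.zero_notMem z ((hDD _).1 H)
      have hz' : ∀ z, ((h.symm (zeroPoint D' z) : codeSet D) : G.carrier × I).2 = 0 := fun z =>
        (h.symm _).2.resolve_right fun H => hD'.zero_notMem z (by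
          rw [← hDD, h.apply_symm_apply] at H
          exact H)
      let k : G.carrier ≃ₜ G'.carrier :=
        { toFun := fun z => (h (zeroPoint D z) : G'.carrier × I).1
          invFun := fun z => (h.symm (zeroPoint D' z) : G.carrier × I).1
          left_inv := fun z => by
            change (h.symm (zeroPoint D' (h (zeroPoint D z) : G'.carrier × I).1) :
              G.carrier × I).1 = z
            rw [← eq_zeroPoint (hz z), h.symm_apply_apply]
            rfl
          right_inv := fun z => by
            change (h (zeroPoint D (h.symm (zeroPoint D' z) : G.carrier × I).1) :
              G'.carrier × I).1 = z
            rw [← eq_zeroPoint (hz' z), h.apply_symm_apply]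
            rfl
          continuous_toFun := continuous_fst.comp (continuous_subtype_val.comp
            (h.continuous.comp (continuous_zeroPoint D)))
          continuous_invFun := continuous_fst.comp (continuous_subtype_val.comp
            (h.symm.continuous.comp (continuous_zeroPoint D'))) }
      have hk : ∀ z, h (zeroPoint D z) = zeroPoint D' (k z) := fun z => eq_zeroPoint (hz z)
      obtain ⟨f, hf, hLL⟩ := ih hG hG' (fun A hA => hL A (by simp [hA]))
        (fun B hB => hL' B (by simp [hB])) k
      refine ⟨f, fun x => (hk _).trans (by rw [hf]; rfl), List.rel_append hLL (.cons ?_ .nil)⟩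
      have himg : h '' {p : codeSet D | (p : G.carrier × I) ∈ D} =
          {p : codeSet D' | (p : G'.carrier × I) ∈ D'} := by
        ext p
        obtain ⟨q, rfl⟩ := h.surjective p
        rw [h.injective.mem_set_image]
        exact (hDD q).symm
      ext y
      obtain ⟨x, rfl⟩ := f.surjective y
      rw [f.injective.mem_set_image]
      have h1 : x ∈ A ↔ G.base x ∈ G.added ∪ G.base '' A := by
        rw [mem_union, hGc.injective_base.mem_set_image]
        exact (or_iff_right fun H => H ⟨x, rfl⟩).symm
      have h2 : f x ∈ B ↔ G'.base (f x) ∈ G'.added ∪ G'.base '' B := by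
        rw [mem_union, hGc'.injective_base.mem_set_image]
        exact (or_iff_right fun H => H ⟨f x, rfl⟩).symm
      rw [h1, h2, ← mem_closure_attach_iff hD, ← mem_closure_attach_iff hD', ← himg,
        ← h.image_closure, ← hf, ← hk, h.injective.mem_set_image]

end SpaceOver

/-! ### Fans -/

theorem Fan.mk_eq_mk_iff {Z : Type u} {z w : Z} {s t : I} :
    (Quotient.mk (fanSetoid Z) (z, s) = Quotient.mk (fanSetoid Z) (w, t)) ↔
      (z = w ∧ s = t) ∨ (s = 1 ∧ t = 1) := by
  rw [Quotient.eq]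
  change ((z, s) = (w, t) ∨ (s = 1 ∧ t = 1)) ↔ _
  rw [Prod.mk.injEq]

/-- The second coordinate, as a function on the fan. -/
def Fan.height {Z : Type u} : Fan Z → I :=
  Quotient.lift Prod.snd (by
    rintro p q (rfl | ⟨h, h'⟩)
    · rfl
    · rw [h, h'])

theorem Fan.continuous_height {Z : Type u} [TopologicalSpace Z] :
    Continuous (Fan.height : Fan Z → I) :=
  continuous_snd.quotient_lift _

theorem Fan.isOpen_image_prod {Z : Type u} [TopologicalSpace Z] {U : Set Z} (hU : IsOpen U) :
    IsOpen (Quotient.mk (fanSetoid Z) '' (U ×ˢ Iio 1)) := by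
  rw [← isQuotientMap_quotient_mk'.isOpen_preimage]
  convert hU.prod (isOpen_Iio (a := (1 : I)))
  ext ⟨z, s⟩
  constructor
  · rintro ⟨⟨w, t⟩, ⟨hw, ht⟩, h⟩
    rcases Fan.mk_eq_mk_iff.1 h with ⟨rfl, rfl⟩ | ⟨h, -⟩
    · exact ⟨hw, ht⟩
    · exact absurd h (ne_of_lt ht)
  · exact fun h => ⟨_, h, rfl⟩

namespace fanOver

section basic

variable {Z : Type u} {B : Set Z}

/-- The copy of `Z` at height `0`. -/
def base (B : Set Z) (z : Z) : fanOver Z B :=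
  ⟨Quotient.mk _ (z, 0), (z, 0), Or.inl rfl, rfl⟩

/-- The ray from a point of `B` at height `0` to the apex. -/
def ray (b : B) (t : I) : fanOver Z B :=
  ⟨Quotient.mk _ ((b : Z), t), ((b : Z), t), Or.inr b.2, rfl⟩

/-- The height above the copy of `Z`. -/
def height (x : fanOver Z B) : I :=
  Fan.height (x : Fan Z)

theorem ray_zero (b : B) : ray b 0 = base B b := rfl

theorem ray_one (b c : B) : ray b 1 = ray c 1 :=
  Subtype.ext (Fan.mk_eq_mk_iff.2 (Or.inr ⟨rfl, rfl⟩))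

theorem ray_eq_ray_iff {b c : B} {s t : I} :
    ray b s = ray c t ↔ (b = c ∧ s = t) ∨ (s = 1 ∧ t = 1) := by
  rw [Subtype.ext_iff, Subtype.ext_iff]
  exact Fan.mk_eq_mk_iff

theorem base_injective : Function.Injective (base B) := by
  intro z w h
  rcases Fan.mk_eq_mk_iff.1 (congrArg Subtype.val h) with ⟨h, -⟩ | ⟨h, -⟩
  · exact h
  · exact absurd h zero_ne_one

theorem exists_eq (x : fanOver Z B) : (∃ z, x = base B z) ∨ ∃ b t, x = ray b t := by
  obtain ⟨_, ⟨z, s⟩, h | h, rfl⟩ := x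
  · obtain rfl : s = 0 := h
    exact Or.inl ⟨z, rfl⟩
  · exact Or.inr ⟨⟨z, h⟩, s, rfl⟩

theorem eq_of_height_eq_one {x y : fanOver Z B} (hx : height x = 1) (hy : height y = 1) :
    x = y := by
  obtain ⟨z, rfl⟩ | ⟨b, s, rfl⟩ := exists_eq x
  · exact absurd hx zero_ne_one
  obtain ⟨z, rfl⟩ | ⟨c, t, rfl⟩ := exists_eq y
  · exact absurd hy zero_ne_one
  exact ray_eq_ray_iff.2 (Or.inr ⟨hx, hy⟩)

theorem range_base : range (base B) = {x | height x = 0} := by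
  ext x
  constructor
  · rintro ⟨z, rfl⟩
    rfl
  · intro hx
    obtain ⟨z, rfl⟩ | ⟨b, s, rfl⟩ := exists_eq x
    · exact ⟨z, rfl⟩
    · obtain rfl : s = 0 := hx
      exact ⟨b, rfl⟩

end basic

variable {Z : Type u} [TopologicalSpace Z] {B : Set Z}

theorem continuous_height : Continuous (height : fanOver Z B → I) :=
  Fan.continuous_height.comp continuous_subtype_val

theorem continuous_ray : Continuous fun p : B × I => ray p.1 p.2 :=
  (continuous_quotient_mk'.comp
    ((continuous_subtype_val.comp continuous_fst).prodMk continuous_snd)).subtype_mk _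

theorem continuous_ray_right (b : B) : Continuous (ray b) :=
  continuous_ray.comp (Continuous.prodMk_right b)

theorem continuous_base : Continuous (base B) :=
  (continuous_quotient_mk'.comp (continuous_id.prodMk continuous_const)).subtype_mk _

theorem isClosedEmbedding_base : IsClosedEmbedding (base B) := by
  refine ⟨⟨⟨le_antisymm continuous_base.le_induced ?_⟩, base_injective⟩, ?_⟩
  · intro U hU
    refine ⟨_, (Fan.isOpen_image_prod hU).preimage continuous_subtype_val, ?_⟩
    ext z
    constructor
    · rintro ⟨⟨w, t⟩, ⟨hw, ht⟩, h⟩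
      rcases Fan.mk_eq_mk_iff.1 h with ⟨rfl, rfl⟩ | ⟨h, -⟩
      · exact hw
      · exact absurd h (ne_of_lt ht)
    · exact fun hz => ⟨(z, 0), ⟨hz, show (0 : I) < 1 from zero_lt_one⟩, rfl⟩
  · rw [range_base]
    exact isClosed_eq continuous_height continuous_const

theorem isOpen_base_image (hB : IsClosed B) : IsOpen (base B '' Bᶜ) := by
  convert (Fan.isOpen_image_prod hB.isOpen_compl).preimage
    (continuous_subtype_val : Continuous (Subtype.val : fanOver Z B → Fan Z))
  ext x
  constructor
  · rintro ⟨z, hz, rfl⟩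
    exact ⟨(z, 0), ⟨hz, show (0 : I) < 1 from zero_lt_one⟩, rfl⟩
  · rintro ⟨⟨z, s⟩, ⟨hz, hs⟩, h⟩
    obtain ⟨w, rfl⟩ | ⟨b, t, rfl⟩ := exists_eq x
    · rcases Fan.mk_eq_mk_iff.1 h with ⟨rfl, -⟩ | ⟨-, h⟩
      · exact ⟨z, hz, rfl⟩
      · exact absurd h zero_ne_one
    · rcases Fan.mk_eq_mk_iff.1 h with ⟨rfl, -⟩ | ⟨h, -⟩
      · exact absurd b.2 hz
      · exact absurd h (ne_of_lt hs)

/-- Functoriality of the fan over a pair. -/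
theorem nonempty_homeomorph {Z' : Type v} [TopologicalSpace Z'] {B' : Set Z'} (h : Z ≃ₜ Z')
    (hB : h '' B = B') : Nonempty (fanOver Z B ≃ₜ fanOver Z' B') := by
  let F : Fan Z ≃ₜ Fan Z' :=
    { toEquiv := Quotient.congr (h.toEquiv.prodCongr (Equiv.refl I)) (by
        rintro ⟨z, s⟩ ⟨w, t⟩
        change ((z, s) = (w, t) ∨ (s = 1 ∧ t = 1)) ↔ ((h z, s) = (h w, t) ∨ (s = 1 ∧ t = 1))
        rw [Prod.mk.injEq, Prod.mk.injEq, h.injective.eq_iff])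
      continuous_toFun := isQuotientMap_quotient_mk'.continuous_iff.2
        (continuous_quotient_mk'.comp (h.prodCongr (Homeomorph.refl I)).continuous)
      continuous_invFun := isQuotientMap_quotient_mk'.continuous_iff.2
        (continuous_quotient_mk'.comp (h.prodCongr (Homeomorph.refl I)).symm.continuous) }
  have hF : ∀ z s, F (Quotient.mk _ (z, s)) = Quotient.mk _ (h z, s) := fun _ _ => rfl
  have himg : F '' fanOver Z B = fanOver Z' B' := by
    ext y
    constructor
    · rintro ⟨_, ⟨⟨z, s⟩, hz, rfl⟩, rfl⟩
      exact ⟨(h z, s), hz.imp id fun hz => hB.le ⟨z, hz, rfl⟩, rfl⟩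
    · rintro ⟨⟨z, s⟩, hz, rfl⟩
      refine ⟨_, ⟨(h.symm z, s), hz.imp id fun hz => ?_, rfl⟩, ?_⟩
      · obtain ⟨w, hw, rfl⟩ := hB.ge hz
        simpa using hw
      · rw [hF, h.apply_symm_apply]
  exact ⟨(F.image _).trans (Homeomorph.setCongr himg)⟩

/-- A set of points on the rays that is closed under moving up is star-shaped about the apex. -/
theorem isPreconnected_upper {P : B → I → Prop} (hP : ∀ b s t, s ≤ t → P b s → P b t) :
    IsPreconnected {x : fanOver Z B | ∃ b t, P b t ∧ ray b t = x} := by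
  rcases B.eq_empty_or_nonempty with rfl | ⟨c, hc⟩
  · convert isPreconnected_empty
    rw [eq_empty_iff_forall_notMem]
    rintro x ⟨b, -⟩
    exact b.2
  refine isPreconnected_of_forall (ray ⟨c, hc⟩ 1) ?_
  rintro _ ⟨b, t, hbt, rfl⟩
  refine ⟨ray b '' Ici t, ?_, ?_, ⟨t, self_mem_Ici, rfl⟩,
    isPreconnected_Ici.image _ (continuous_ray_right b).continuousOn⟩
  · rintro _ ⟨t', ht, rfl⟩
    exact ⟨b, t', hP _ _ _ ht hbt, rfl⟩
  · exact ⟨1, le_one', ray_one _ _⟩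

theorem isPreconnected_base_image_diff {K : Set Z} (hK : IsPreconnected K)
    (hK' : ∀ z, IsPreconnected (K \ {z})) (p : fanOver Z B) :
    IsPreconnected (base B '' K \ {p}) := by
  by_cases hp : p ∈ range (base B)
  · obtain ⟨z, rfl⟩ := hp
    rw [← image_singleton, ← image_sdiff base_injective]
    exact (hK' z).image _ continuous_base.continuousOn
  · rw [sdiff_eq_left.2 (disjoint_singleton_right.2 fun h => hp (image_subset_range _ _ h))]
    exact hK.image _ continuous_base.continuousOn

/-- A punctured fan is a union of three connected sets, unless the puncture is at the apex and
there are several rays: the rest of the base outside `B`, the piece of a ray below the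
puncture, and the rest of the rays, which is star-shaped about the apex. -/
theorem exists_finite_cover {K : Set Z} (hKB : K ∪ B = univ) (hK : IsPreconnected K)
    (hK' : ∀ z, IsPreconnected (K \ {z})) (p : fanOver Z B)
    (hp : height p = 1 → B.Subsingleton) :
    ∃ T : Set (Set (fanOver Z B)), T.Finite ∧ (∀ t ∈ T, IsPreconnected t) ∧ ⋃₀ T = {p}ᶜ := by
  have h1 := isPreconnected_base_image_diff hK hK' p
  have hcases : ∀ x : fanOver Z B, x ∈ base B '' K ∨ ∃ b t, x = ray b t := by
    intro x
    obtain ⟨z, rfl⟩ | h := exists_eq x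
    · exact (hKB.ge (mem_univ z)).imp (fun hz => ⟨z, hz, rfl⟩) fun hz => ⟨⟨z, hz⟩, 0, rfl⟩
    · exact Or.inr h
  by_cases hpr : ∃ b₀ s₀, p = ray b₀ s₀
  · obtain ⟨b₀, s₀, rfl⟩ := hpr
    refine ⟨{base B '' K \ {ray b₀ s₀}, ray b₀ '' Iio s₀,
      {x | ∃ b t, (b ≠ b₀ ∨ s₀ < t) ∧ ray b t = x}}, toFinite _, ?_, ?_⟩
    · rintro t (rfl | rfl | rfl)
      · exact h1
      · exact isPreconnected_Iio.image _ (continuous_ray_right b₀).continuousOn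
      · exact isPreconnected_upper fun b s t hst => Or.imp_right fun h => h.trans_le hst
    rw [sUnion_insert, sUnion_insert, sUnion_singleton]
    refine subset_antisymm (union_subset (fun x hx => hx.2) (union_subset ?_ ?_)) fun x hx => ?_
    · rintro _ ⟨t, ht, rfl⟩ h
      exact (mem_Iio.1 ht).ne (congrArg height (mem_singleton_iff.1 h))
    · rintro _ ⟨b, t, hbt, rfl⟩ h
      have ht : t = s₀ := congrArg height (mem_singleton_iff.1 h)
      subst ht
      have hb : b ≠ b₀ := hbt.resolve_right (lt_irrefl _)
      rcases ray_eq_ray_iff.1 h with ⟨h, -⟩ | ⟨h, -⟩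
      · exact hb h
      · exact hb (Subtype.ext (hp h b.2 b₀.2))
    · obtain h | ⟨b, t, rfl⟩ := hcases x
      · exact Or.inl ⟨h, hx⟩
      by_cases hb : b = b₀
      · subst hb
        rcases lt_trichotomy t s₀ with h | rfl | h
        · exact Or.inr (Or.inl ⟨t, h, rfl⟩)
        · exact absurd rfl hx
        · exact Or.inr (Or.inr ⟨b, t, Or.inr h, rfl⟩)
      · exact Or.inr (Or.inr ⟨b, t, Or.inl hb, rfl⟩)
  · refine ⟨{base B '' K \ {p}, {x | ∃ b t, True ∧ ray b t = x}}, toFinite _, ?_, ?_⟩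
    · rintro t (rfl | rfl)
      · exact h1
      · exact isPreconnected_upper fun _ _ _ _ h => h
    rw [sUnion_insert, sUnion_singleton]
    refine subset_antisymm (union_subset (fun x hx => hx.2) ?_) fun x hx => ?_
    · rintro _ ⟨b, t, -, rfl⟩ h
      exact hpr ⟨b, t, h.symm⟩
    · obtain h | ⟨b, t, rfl⟩ := hcases x
      · exact Or.inl ⟨h, hx⟩
      · exact Or.inr ⟨b, t, trivial, rfl⟩

end fanOver

/-! ### Topological recognition of the parts of a fan -/

section intrinsic

variable {J : Type u} [TopologicalSpace J] {J' : Type v} [TopologicalSpace J']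

/-- Removing `p` leaves finitely many connected pieces (the pieces may overlap). -/
def HasFiniteComplement (p : J) : Prop :=
  ∃ T : Set (Set J), T.Finite ∧ (∀ t ∈ T, IsPreconnected t) ∧ ⋃₀ T = {p}ᶜ

/-- `U` is an open component of the complement of `v` that has `v` in its closure. -/
structure IsBranch (v : J) (U : Set J) : Prop where
  isOpen : IsOpen U
  isPreconnected : IsPreconnected U
  notMem : v ∉ U
  mem_closure : v ∈ closure U
  closure_subset : closure U ⊆ insert v U

/-- The points of the branches at `v` that do not cut their branch. -/
def branchTips (v : J) : Set J :=
  {p | ∃ U, IsBranch v U ∧ p ∈ U ∧ IsPreconnected (U \ {p})}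

/-- The closure of the tips of the branches at `v`, together with everything that is not a limit
of branches. -/
def spine (v : J) : Set J :=
  closure (branchTips v) ∪ (closure (⋃₀ {U | IsBranch v U}))ᶜ

/-- The union of all connected clopen sets without cut-points. -/
def uncutCore (J : Type u) [TopologicalSpace J] : Set J :=
  ⋃₀ {U | IsClopen U ∧ IsPreconnected U ∧ ∀ p ∈ U, IsPreconnected (U \ {p})}

theorem HasFiniteComplement.image {p : J} (h : HasFiniteComplement p) (g : J ≃ₜ J') :
    HasFiniteComplement (g p) := by
  obtain ⟨T, hT, hc, hu⟩ := h
  refine ⟨(fun t => g '' t) '' T, hT.image _, ?_, ?_⟩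
  · rintro _ ⟨t, ht, rfl⟩
    exact (hc t ht).image _ g.continuous.continuousOn
  · rw [← image_sUnion, hu, image_compl_eq g.bijective, image_singleton]

theorem IsBranch.image {v : J} {U : Set J} (h : IsBranch v U) (g : J ≃ₜ J') :
    IsBranch (g v) (g '' U) where
  isOpen := g.isOpenMap _ h.isOpen
  isPreconnected := h.isPreconnected.image _ g.continuous.continuousOn
  notMem := by
    rw [g.injective.mem_set_image]
    exact h.notMem
  mem_closure := by
    rw [← g.image_closure, g.injective.mem_set_image]
    exact h.mem_closure
  closure_subset := by
    rw [← g.image_closure, ← image_insert_eq]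
    exact image_mono h.closure_subset

theorem IsBranch.subset_of_nonempty_inter {v : J} {U s : Set J}
    (hU : IsBranch v U) (hs : IsPreconnected s) (hv : v ∉ s) (h : (s ∩ U).Nonempty) : s ⊆ U := by
  refine hs.subset_of_closure_inter_subset hU.isOpen h fun x hx => ?_
  exact (hU.closure_subset hx.1).resolve_left fun h => hv (h ▸ hx.2)

theorem image_branchTips_subset (g : J ≃ₜ J') (v : J) :
    g '' branchTips v ⊆ branchTips (g v) := by
  rintro _ ⟨p, ⟨U, hU, hp, hc⟩, rfl⟩
  refine ⟨_, hU.image g, mem_image_of_mem _ hp, ?_⟩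
  rw [← image_singleton, ← image_sdiff g.injective]
  exact hc.image _ g.continuous.continuousOn

theorem image_sUnion_branch_subset (g : J ≃ₜ J') (v : J) :
    g '' ⋃₀ {U | IsBranch v U} ⊆ ⋃₀ {U | IsBranch (g v) U} := by
  rintro _ ⟨p, ⟨U, hU, hp⟩, rfl⟩
  exact ⟨_, IsBranch.image hU g, mem_image_of_mem _ hp⟩

theorem image_uncutCore_subset (g : J ≃ₜ J') : g '' uncutCore J ⊆ uncutCore J' := by
  rintro _ ⟨p, ⟨U, ⟨hU, hc, hp⟩, hpU⟩, rfl⟩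
  refine ⟨g '' U, ⟨⟨g.isClosedMap _ hU.1, g.isOpenMap _ hU.2⟩,
    hc.image _ g.continuous.continuousOn, ?_⟩,
    mem_image_of_mem _ hpU⟩
  rintro _ ⟨q, hq, rfl⟩
  rw [← image_singleton, ← image_sdiff g.injective]
  exact (hp q hq).image _ g.continuous.continuousOn

/-- An equality of sets that follows from one inclusion natural in the homeomorphism. -/
theorem image_eq_of_subset (g : J ≃ₜ J') {s : Set J} {s' : Set J'} (h : g '' s ⊆ s')
    (h' : g.symm '' s' ⊆ s) : g '' s = s' := by
  refine h.antisymm fun x hx => ⟨g.symm x, h' ⟨x, hx, rfl⟩, g.apply_symm_apply x⟩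

theorem image_spine (g : J ≃ₜ J') (v : J) : g '' spine v = spine (g v) := by
  have h1 : g '' branchTips v = branchTips (g v) :=
    image_eq_of_subset g (image_branchTips_subset g v) (by
      simpa using image_branchTips_subset g.symm (g v))
  have h2 : g '' ⋃₀ {U | IsBranch v U} = ⋃₀ {U | IsBranch (g v) U} :=
    image_eq_of_subset g (image_sUnion_branch_subset g v) (by
      simpa using image_sUnion_branch_subset g.symm (g v))
  rw [spine, spine, image_union, image_compl_eq g.bijective, g.image_closure, g.image_closure,
    h1, h2]

theorem image_uncutCore (g : J ≃ₜ J') : g '' uncutCore J = uncutCore J' :=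
  image_eq_of_subset g (image_uncutCore_subset g) (image_uncutCore_subset g.symm)

/-- A homeomorphism that matches the ranges of two embeddings lifts along them. -/
theorem exists_homeomorph_of_image_range {W : Type*} {W' : Type*} [TopologicalSpace W]
    [TopologicalSpace W'] {e : W → J} {e' : W' → J'} (he : IsEmbedding e) (he' : IsEmbedding e')
    (g : J ≃ₜ J') (h : g '' range e = range e') :
    ∃ k : W ≃ₜ W', ∀ w, g (e w) = e' (k w) := by
  refine ⟨(he.toHomeomorph.trans (g.image _)).trans
    ((Homeomorph.setCongr h).trans he'.toHomeomorph.symm), fun w => ?_⟩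
  have := congrArg Subtype.val (he'.toHomeomorph.apply_symm_apply
    (Homeomorph.setCongr h ((g.image _) (he.toHomeomorph w))))
  exact this.symm

end intrinsic

namespace fanOver

variable {Z : Type u} [TopologicalSpace Z] {B : Set Z}

/-- A half-open ray is cut by each of its points except the one at height `0`. -/
theorem eq_base_of_isPreconnected {s : Set I} {b : B} {p : fanOver Z B} (hs : Iio 1 ⊆ s)
    (hp : p ∈ ray b '' Iio 1) (h : IsPreconnected (ray b '' s \ {p})) : p = base B b := by
  obtain ⟨t, ht, rfl⟩ := hp
  have ht1 : t < 1 := ht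
  by_contra hne
  have ht0 : 0 < t := unitInterval.pos_iff_ne_zero.2 fun h0 => hne (by rw [h0, ray_zero])
  obtain ⟨r, htr, hr1⟩ := exists_between ht1
  have hord := (h.image _ continuous_height.continuousOn).ordConnected
  have h0 : (0 : I) ∈ height '' (ray b '' s \ {ray b t}) :=
    ⟨ray b 0, ⟨⟨0, hs (mem_Iio.2 zero_lt_one), rfl⟩, fun h => ht0.ne (congrArg height h)⟩, rfl⟩
  have hr : r ∈ height '' (ray b '' s \ {ray b t}) :=
    ⟨ray b r, ⟨⟨r, hs hr1, rfl⟩, fun h => htr.ne' (congrArg height h)⟩, rfl⟩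
  obtain ⟨_, ⟨⟨t', -, rfl⟩, hx⟩, hxt⟩ := hord.out h0 hr ⟨ht0.le, htr.le⟩
  exact hx (congrArg (ray b) hxt)

theorem isOpen_ray_image {b : B} (hb : IsOpen ({(b : Z)} : Set Z)) : IsOpen (ray b '' Iio 1) := by
  convert (Fan.isOpen_image_prod hb).preimage
    (continuous_subtype_val : Continuous (Subtype.val : fanOver Z B → Fan Z))
  ext x
  constructor
  · rintro ⟨t, ht, rfl⟩
    exact ⟨((b : Z), t), ⟨rfl, ht⟩, rfl⟩
  · rintro ⟨⟨z, t⟩, ⟨hz, ht⟩, h⟩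
    obtain rfl : z = b := hz
    exact ⟨t, ht, Subtype.ext h⟩

theorem mem_closure_ray_image (b : B) (t : I) : ray b t ∈ closure (ray b '' Iio 1) := by
  have : t ∈ closure (Iio (1 : I)) := by
    rw [closure_Iio' ⟨0, zero_lt_one⟩]
    exact le_one'
  exact map_mem_closure (continuous_ray_right b) this (mapsTo_image _ _)

section rays

variable [T1Space Z] {D : Set B}

theorem closure_ray_image_subset (b : B) :
    closure (ray b '' Iio 1) ⊆ range (ray b) := by
  have hopen := (Fan.isOpen_image_prod (isOpen_compl_singleton (x := (b : Z)))).preimage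
    (continuous_subtype_val : Continuous (Subtype.val : fanOver Z B → Fan Z))
  refine (closure_minimal ?_ hopen.isClosed_compl).trans fun x hx => ?_
  · rintro _ ⟨t, -, rfl⟩ ⟨⟨z, s⟩, ⟨hz, hs⟩, h⟩
    rcases Fan.mk_eq_mk_iff.1 h with ⟨h, -⟩ | ⟨h, -⟩
    · exact hz h
    · exact (mem_Iio.1 hs).ne h
  · obtain ⟨z, rfl⟩ | ⟨c, t, rfl⟩ := exists_eq x
    · have hz : z = b := not_not.1 fun h => hx ⟨(z, 0), ⟨h, mem_Iio.2 zero_lt_one⟩, rfl⟩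
      exact ⟨0, by rw [hz, ray_zero]⟩
    · rcases lt_or_eq_of_le (le_one' : t ≤ 1) with ht | rfl
      · have hc : (c : Z) = b := not_not.1 fun h => hx ⟨(c, t), ⟨h, ht⟩, rfl⟩
        exact ⟨t, by rw [Subtype.ext hc]⟩
      · exact ⟨1, ray_one _ _⟩

theorem isBranch_ray_image {b : B} (hb : IsOpen ({(b : Z)} : Set Z)) :
    IsBranch (ray b 1) (ray b '' Iio 1) where
  isOpen := isOpen_ray_image hb
  isPreconnected := isPreconnected_Iio.image _ (continuous_ray_right b).continuousOn
  notMem := by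
    rintro ⟨t, ht, h⟩
    exact (mem_Iio.1 ht).ne (congrArg height h)
  mem_closure := mem_closure_ray_image b 1
  closure_subset := by
    refine (closure_ray_image_subset b).trans ?_
    rintro _ ⟨t, rfl⟩
    rcases lt_or_eq_of_le (le_one' : t ≤ 1) with h | rfl
    · exact Or.inr ⟨t, h, rfl⟩
    · exact Or.inl rfl

variable (hD : Dense D) (hDo : ∀ d ∈ D, IsOpen ({(d : Z)} : Set Z))
include hD hDo

theorem isBranch_iff {v : fanOver Z B} (hv : height v = 1) {U : Set (fanOver Z B)} :
    IsBranch v U ↔ ∃ d ∈ D, U = ray d '' Iio 1 := by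
  constructor
  · intro hU
    obtain ⟨x, hx0, hxU⟩ := mem_closure_iff.1 hU.mem_closure {x | 0 < height x}
      (isOpen_lt continuous_const continuous_height) (by rw [mem_ofPred_eq, hv]; exact zero_lt_one)
    obtain ⟨z, rfl⟩ | ⟨b, t, rfl⟩ := exists_eq x
    · exact absurd hx0 (lt_irrefl (0 : I))
    have hvr : ∀ c : B, v ∉ ray c '' Iio 1 := by
      rintro c ⟨s, hs, rfl⟩
      exact (mem_Iio.1 hs).ne hv
    have ht : t < 1 := lt_of_le_of_ne le_one' fun h =>
      hU.notMem (eq_of_height_eq_one (x := v) (y := ray b t) hv h ▸ hxU)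
    have hbU : ray b '' Iio 1 ⊆ U := hU.subset_of_nonempty_inter
      (isPreconnected_Iio.image _ (continuous_ray_right b).continuousOn) (hvr b)
      ⟨_, ⟨t, ht, rfl⟩, hxU⟩
    -- The foot of this ray is a limit of feet of rays over isolated points.
    obtain ⟨d, hdU, hd⟩ := hD.inter_open_nonempty ((fun c : B => ray c 0) ⁻¹' U)
      (hU.isOpen.preimage (continuous_ray.comp (Continuous.prodMk_left 0)))
      ⟨b, hbU ⟨0, mem_Iio.2 zero_lt_one, rfl⟩⟩
    have hdb := isBranch_ray_image (hDo d hd)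
    rw [eq_of_height_eq_one (x := ray d 1) rfl hv] at hdb
    refine ⟨d, hd, subset_antisymm ?_ ?_⟩
    · exact hdb.subset_of_nonempty_inter hU.isPreconnected hU.notMem
        ⟨_, hdU, ⟨0, mem_Iio.2 zero_lt_one, rfl⟩⟩
    · exact hU.subset_of_nonempty_inter hdb.isPreconnected hdb.notMem
        ⟨_, ⟨0, mem_Iio.2 zero_lt_one, rfl⟩, hdU⟩
  · rintro ⟨d, hd, rfl⟩
    rw [eq_of_height_eq_one (y := ray d 1) hv rfl]
    exact isBranch_ray_image (hDo d hd)

theorem branchTips_eq {v : fanOver Z B} (hv : height v = 1) :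
    branchTips v = base B '' (Subtype.val '' D) := by
  ext p
  constructor
  · rintro ⟨U, hU, hp, hc⟩
    obtain ⟨d, hd, rfl⟩ := (isBranch_iff hD hDo hv).1 hU
    exact ⟨d, ⟨d, hd, rfl⟩, (eq_base_of_isPreconnected subset_rfl hp hc).symm⟩
  · rintro ⟨_, ⟨d, hd, rfl⟩, rfl⟩
    refine ⟨_, (isBranch_iff hD hDo hv).2 ⟨d, hd, rfl⟩, ⟨0, mem_Iio.2 zero_lt_one, rfl⟩, ?_⟩
    have : ray d '' Iio 1 \ {base B d} = ray d '' Ioo 0 1 := by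
      ext x
      constructor
      · rintro ⟨⟨t, ht, rfl⟩, hx⟩
        exact ⟨t, ⟨unitInterval.pos_iff_ne_zero.2 fun h0 => hx (by rw [h0]; rfl), ht⟩, rfl⟩
      · rintro ⟨t, ht, rfl⟩
        exact ⟨⟨t, ht.2, rfl⟩, fun h => ht.1.ne' (congrArg height h)⟩
    rw [this]
    exact isPreconnected_Ioo.image _ (continuous_ray_right d).continuousOn

theorem mem_closure_branches {v : fanOver Z B} (hv : height v = 1) (b : B) (t : I) :
    ray b t ∈ closure (⋃₀ {U | IsBranch v U}) := by
  have h : ∀ d ∈ D, ray d t ∈ closure (⋃₀ {U | IsBranch v U}) := fun d hd =>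
    closure_mono (subset_sUnion_of_mem ((isBranch_iff hD hDo hv).2 ⟨d, hd, rfl⟩))
      (mem_closure_ray_image d t)
  have := map_mem_closure (continuous_ray.comp (Continuous.prodMk_left t)) (hD b) h
  rwa [closure_closure] at this

theorem spine_eq (hB : IsClosed B) {v : fanOver Z B} (hv : height v = 1) :
    spine v = range (base B) := by
  have hBD : closure (Subtype.val '' D) = B := by
    refine (closure_minimal ?_ hB).antisymm fun b hb => closure_subtype.1 (hD ⟨b, hb⟩)
    rintro _ ⟨d, -, rfl⟩
    exact d.2
  rw [spine, branchTips_eq hD hDo hv, isClosedEmbedding_base.closure_image_eq, hBD]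
  refine subset_antisymm (union_subset (image_subset_range _ _) fun x hx => ?_) ?_
  · obtain ⟨z, rfl⟩ | ⟨b, t, rfl⟩ := exists_eq x
    · exact ⟨z, rfl⟩
    · exact absurd (mem_closure_branches hD hDo hv b t) hx
  · rintro _ ⟨z, rfl⟩
    by_cases hz : z ∈ B
    · exact Or.inl ⟨z, hz, rfl⟩
    · refine Or.inr fun h => ?_
      obtain ⟨_, ⟨w, hw, rfl⟩, U, hU, hx⟩ := mem_closure_iff.1 h _
        (isOpen_base_image hB) ⟨z, hz, rfl⟩
      obtain ⟨d, hd, rfl⟩ := (isBranch_iff hD hDo hv).1 hU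
      obtain ⟨t, -, ht⟩ := hx
      have : t = 0 := congrArg height ht
      subst this
      exact hw (base_injective ht ▸ d.2)

theorem not_hasFiniteComplement (hinf : D.Infinite) {v : fanOver Z B} (hv : height v = 1) :
    ¬ HasFiniteComplement v := by
  rintro ⟨T, hT, hc, hu⟩
  have hex : ∀ d : D, ∃ t ∈ T, base B (d : B) ∈ t := by
    intro d
    have : base B (d : B) ∈ ⋃₀ T := by
      rw [hu]
      intro h
      exact zero_ne_one ((congrArg height (mem_singleton_iff.1 h)).trans hv)
    exact this
  choose t htT hdt using hex
  have := hinf.to_subtype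
  have := hT.to_subtype
  refine not_injective_infinite_finite (fun d : D => (⟨t d, htT d⟩ : T)) fun d e hde => ?_
  have hde' : t d = t e := congrArg Subtype.val hde
  have hd : t d ⊆ ray (d : B) '' Iio 1 := by
    refine ((isBranch_iff hD hDo hv).2 ⟨d, d.2, rfl⟩).subset_of_nonempty_inter (hc _ (htT d))
      (fun h => ?_) ⟨_, hdt d, ⟨0, mem_Iio.2 zero_lt_one, rfl⟩⟩
    exact hu.le (mem_sUnion_of_mem h (htT d)) rfl
  obtain ⟨s, hs, h⟩ := hd (hde' ▸ hdt e)
  have : s = 0 := congrArg height h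
  subst this
  exact Subtype.ext (Subtype.ext (base_injective h))

end rays

/-- With at most one ray, a clopen one, the uncut core is the base outside `B`. -/
theorem uncutCore_eq (hB : IsClosed B) (hBo : IsOpen B) (hBs : B.Subsingleton)
    (hK : IsPreconnected Bᶜ) (hK' : ∀ z, IsPreconnected (Bᶜ \ {z})) :
    uncutCore (fanOver Z B) = base B '' Bᶜ := by
  have hclopen : IsClopen (base B '' Bᶜ) :=
    ⟨isClosedEmbedding_base.isClosedMap _ hBo.isClosed_compl, isOpen_base_image hB⟩
  refine subset_antisymm ?_ fun x hx => ⟨_, ⟨hclopen,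
    hK.image _ continuous_base.continuousOn,
    fun p _ => isPreconnected_base_image_diff hK hK' p⟩, hx⟩
  rintro p ⟨U, ⟨hU, hUc, hUp⟩, hp⟩
  by_contra hpB
  have hpray : ∀ x ∉ base B '' Bᶜ, ∃ b t, x = ray b t := by
    intro x hx
    obtain ⟨z, rfl⟩ | h := exists_eq x
    · exact ⟨⟨z, not_not.1 fun hz => hx ⟨z, hz, rfl⟩⟩, 0, rfl⟩
    · exact h
  obtain ⟨b, t, rfl⟩ := hpray p hpB
  have hdisj : range (ray b) ⊆ U := (isPreconnected_range (continuous_ray_right b)).subset_isClopen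
    hU ⟨_, ⟨t, rfl⟩, hp⟩
  have hsub : U ⊆ ray b '' univ := by
    intro x hx
    have := hUc.subset_isClopen hclopen.compl ⟨_, hp, hpB⟩ hx
    obtain ⟨c, s, rfl⟩ := hpray x this
    rw [Subtype.ext (hBs b.2 c.2)]
    exact ⟨s, trivial, rfl⟩
  obtain rfl : U = ray b '' univ := hsub.antisymm (image_univ.le.trans hdisj)
  -- But `U` is then an arc, which is cut by each of its interior points.
  obtain ⟨r, hr0, hr1⟩ := exists_between (zero_lt_one : (0 : I) < 1)
  have := eq_base_of_isPreconnected (subset_univ _) ⟨r, hr1, rfl⟩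
    (hUp (ray b r) ⟨r, trivial, rfl⟩)
  exact hr0.ne' (congrArg height this)

end fanOver

/-! ### Recovering the base space from the connected coding space -/

namespace SpaceOver

variable {X : Type u} [TopologicalSpace X] {Y : Type v} [TopologicalSpace Y]

theorem isPreconnected_added_compl [ConnectedSpace X] {E : SpaceOver X}
    (hE : E.IsCompactOver) : IsPreconnected E.addedᶜ := by
  rw [added, compl_compl]
  exact isPreconnected_range hE.continuous_base

theorem isPreconnected_added_compl_diff [ConnectedSpace X] (hX : ∀ x : X, ¬ IsCutPoint x)
    {E : SpaceOver X} (hE : E.IsCompactOver) (z : E.carrier) :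
    IsPreconnected (E.addedᶜ \ {z}) := by
  by_cases hz : z ∈ range E.base
  · obtain ⟨x, rfl⟩ := hz
    have : E.addedᶜ \ {E.base x} = E.base '' {x}ᶜ := by
      rw [added, compl_compl, ← image_singleton, ← image_univ,
        ← image_sdiff hE.injective_base, compl_eq_univ_sdiff]
    rw [this]
    exact (not_not.1 (hX x)).image _ hE.continuous_base.continuousOn
  · rw [sdiff_eq_left.2 (disjoint_singleton_right.2 fun h => hz (not_not.1 h))]
    exact isPreconnected_added_compl hE

/-- The two degenerate coding spaces: nothing, or a single isolated point away from `X`, has been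
added. -/
structure IsDegenerate (L : List (Set X)) (E : SpaceOver X) : Prop where
  subsingleton : E.added.Subsingleton
  isOpen : IsOpen E.added
  eq : L = [] ∧ E.added = ∅ ∨ L = [∅] ∧ E.added.Nonempty

/-- Apart from the degenerate cases, infinitely many isolated points are dense in the set of all
added points. -/
theorem Extends.isDegenerate_or [CompactSpace X] [TopologicalSpace.MetrizableSpace X]
    {L : List (Set X)} {E : SpaceOver X} (h : (self X).Extends L E) :
    IsDegenerate L E ∨ ∃ D : Set (closure E.added), D.Infinite ∧ Dense D ∧
      ∀ d ∈ D, IsOpen ({(d : E.carrier)} : Set E.carrier) := by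
  have hself : (self X).added = ∅ := by
    ext x
    exact iff_of_false (fun h => h ⟨x, rfl⟩) id
  cases L using List.reverseRecOn with
  | nil =>
    cases h
    left
    refine ⟨?_, ?_, Or.inl ⟨rfl, hself⟩⟩ <;> rw [hself]
    exacts [subsingleton_empty, isOpen_empty]
  | append_singleton L A =>
    obtain ⟨G, D, hG, hD, rfl⟩ := h.exists_of_concat
    have hGc := hG.isCompactOver isCompactOver_self
    rcases (G.added ∪ G.base '' A).eq_empty_or_nonempty with he | ⟨a, ha⟩
    · left
      obtain ⟨p, rfl⟩ := hD.singleton_of_empty he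
      obtain ⟨hGa, hA⟩ := union_empty_iff.1 he
      obtain rfl : A = ∅ := image_eq_empty.1 hA
      -- Every layer is nonempty, so the layer at hand is the first one.
      have hL : L = [] := by
        cases L using List.reverseRecOn with
        | nil => rfl
        | append_singleton L A =>
          obtain ⟨G', D', hG', hD', rfl⟩ := hG.exists_of_concat
          obtain ⟨q, hq⟩ := hD'.nonempty
          exact absurd (mem_added_attach_of_mem (p := ⟨q, Or.inr hq⟩) hD' hq)
            (eq_empty_iff_forall_notMem.1 hGa _)
      subst hL
      have hadd : (G.attach {p}).added = {(⟨p, Or.inr rfl⟩ : codeSet {p})} := by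
        ext q
        constructor
        · intro hq
          rcases q.2 with h | h
          · exfalso
            obtain ⟨x, hx⟩ := not_not.1 (eq_empty_iff_forall_notMem.1 hGa (q : codeSet {p}).1.1)
            exact hq ⟨x, (congrArg (zeroPoint _) hx).trans (eq_zeroPoint h).symm⟩
          · exact Subtype.ext h
        · rintro rfl
          exact mem_added_attach_of_mem hD rfl
      refine ⟨?_, ?_, Or.inr ⟨rfl, ?_⟩⟩ <;> rw [hadd]
      · exact subsingleton_singleton
      · exact hD.isOpen_singleton_of_mem rfl
      · exact singleton_nonempty _
    · right
      have := hGc.metrizable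
      let c : closure (G.attach D).added → codeSet D := fun d => d.1
      refine ⟨{d | (c d : G.carrier × I) ∈ D}, ?_, ?_, fun d hd => ?_⟩
      · intro hfin
        refine hD.infinite_of_mem_nhds ha Filter.univ_mem ?_
        refine (hfin.image (fun d => (c d : G.carrier × I))).preimage
          Subtype.val_injective.injOn |>.subset ?_
        intro d _
        exact ⟨⟨⟨d, Or.inr d.2⟩, subset_closure (mem_added_attach_of_mem hD d.2)⟩, d.2, rfl⟩
      · refine Subtype.dense_iff.2 ?_
        refine (closure_added_attach hD).le.trans (closure_mono fun p hp => ?_)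
        exact ⟨⟨p, (closure_added_attach hD).ge (subset_closure hp)⟩, hp, rfl⟩
      · exact hD.isOpen_singleton_of_mem hd

section recognition

variable {L : List (Set X)} {L' : List (Set Y)} {E : SpaceOver X} {E' : SpaceOver Y}

theorem hasFiniteComplement [ConnectedSpace X] (hX : ∀ x : X, ¬ IsCutPoint x) (hE : E.IsCompactOver)
    (p : E.ConnectedCode) (hp : fanOver.height p = 1 → (closure E.added).Subsingleton) :
    HasFiniteComplement p := by
  refine fanOver.exists_finite_cover (K := E.addedᶜ) ?_ (isPreconnected_added_compl hE)
    (isPreconnected_added_compl_diff hX hE) p hp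
  exact eq_univ_of_forall fun z => (em (z ∈ E.added)).symm.imp id fun h => subset_closure h

theorem IsDegenerate.uncutCore_eq [ConnectedSpace X] (h : IsDegenerate L E)
    (hX : ∀ x : X, ¬ IsCutPoint x) (hE : E.IsCompactOver) :
    uncutCore E.ConnectedCode = range (fanOver.base (closure E.added) ∘ E.base) := by
  have := hE.metrizable
  have hcl : closure E.added = E.added := h.subsingleton.finite.isClosed.closure_eq
  have hcl' : (closure E.added)ᶜ = range E.base := by rw [hcl, added, compl_compl]
  have := fanOver.uncutCore_eq (B := closure E.added) isClosed_closure
    (by rw [hcl]; exact h.isOpen) (by rw [hcl]; exact h.subsingleton)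
    (by rw [hcl]; exact isPreconnected_added_compl hE)
    (by rw [hcl]; exact isPreconnected_added_compl_diff hX hE)
  rw [this, hcl', range_comp]

theorem IsDegenerate.uncutCore_eq_univ_iff [ConnectedSpace X] (h : IsDegenerate L E)
    (hX : ∀ x : X, ¬ IsCutPoint x) (hE : E.IsCompactOver) :
    uncutCore E.ConnectedCode = univ ↔ E.added = ∅ := by
  rw [h.uncutCore_eq hX hE, range_eq_univ]
  constructor
  · refine fun hs => eq_empty_iff_forall_notMem.2 fun z hz => hz ?_
    obtain ⟨x, hx⟩ := hs (fanOver.base _ z)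
    exact ⟨x, fanOver.base_injective hx⟩
  · intro he x
    obtain ⟨z, rfl⟩ | ⟨⟨b, hb⟩, t, rfl⟩ := fanOver.exists_eq x
    · obtain ⟨x, rfl⟩ := not_not.1 (eq_empty_iff_forall_notMem.1 he z)
      exact ⟨x, rfl⟩
    · rw [he, closure_empty] at hb
      exact absurd hb (notMem_empty b)

/-- A homeomorphism of degenerate connected coding spaces restricts to the base spaces. -/
theorem IsDegenerate.exists_homeomorph [CompactSpace X] [ConnectedSpace X] [CompactSpace Y]
    [ConnectedSpace Y] (h : IsDegenerate L E) (h' : IsDegenerate L' E')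
    (hX : ∀ x : X, ¬ IsCutPoint x) (hY : ∀ y : Y, ¬ IsCutPoint y)
    (hE : E.IsCompactOver) (hE' : E'.IsCompactOver) (g : E.ConnectedCode ≃ₜ E'.ConnectedCode) :
    ∃ f : X ≃ₜ Y, List.Forall₂ (fun A B => f '' A = B) L L' := by
  have := hE.metrizable
  have := hE'.metrizable
  have hg := image_uncutCore g
  have hempty : E.added = ∅ ↔ E'.added = ∅ := by
    rw [← h.uncutCore_eq_univ_iff hX hE, ← h'.uncutCore_eq_univ_iff hY hE', ← hg,
      ← g.injective.image_injective.eq_iff, image_univ, g.range_coe]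
  rw [h.uncutCore_eq hX hE, h'.uncutCore_eq hY hE'] at hg
  obtain ⟨f, -⟩ := exists_homeomorph_of_image_range
    (fanOver.isClosedEmbedding_base.isEmbedding.comp
      (hE.continuous_base.isClosedEmbedding hE.injective_base).isEmbedding)
    (fanOver.isClosedEmbedding_base.isEmbedding.comp
      (hE'.continuous_base.isClosedEmbedding hE'.injective_base).isEmbedding) g hg
  refine ⟨f, ?_⟩
  rcases h.eq with ⟨rfl, h1⟩ | ⟨rfl, h1⟩ <;> rcases h'.eq with ⟨rfl, h2⟩ | ⟨rfl, h2⟩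
  · exact .nil
  · exact absurd (hempty.1 h1) h2.ne_empty
  · exact absurd (hempty.2 h2) h1.ne_empty
  · exact .cons (image_empty _) .nil

variable [CompactSpace X] [TopologicalSpace.MetrizableSpace X]
  [CompactSpace Y] [TopologicalSpace.MetrizableSpace Y]

/-- Unless the coding space is degenerate, a homeomorphism of the connected coding spaces matches
the apexes, hence the spines, which are the coding spaces. -/
theorem exists_homeomorph_carrier [ConnectedSpace Y] (hY : ∀ y : Y, ¬ IsCutPoint y)
    (hE : (self X).Extends L E) (hE' : (self Y).Extends L' E')
    (hEL : ¬ IsDegenerate L E) (g : E.ConnectedCode ≃ₜ E'.ConnectedCode) :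
    Nonempty (E.carrier ≃ₜ E'.carrier) := by
  have hEc := hE.isCompactOver isCompactOver_self
  have hEc' := hE'.isCompactOver isCompactOver_self
  have := hEc.metrizable
  have := hEc'.metrizable
  obtain ⟨D, hDi, hDd, hDo⟩ := hE.isDegenerate_or.resolve_left hEL
  obtain ⟨d, hd⟩ := hDi.nonempty
  have hv : fanOver.height (fanOver.ray d 1) = 1 := rfl
  have hgv : ¬ HasFiniteComplement (g (fanOver.ray d 1)) := fun h =>
    fanOver.not_hasFiniteComplement hDd hDo hDi hv (by simpa using h.image g.symm)
  have hgv1 : fanOver.height (g (fanOver.ray d 1)) = 1 := by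
    by_contra hne
    exact hgv (hasFiniteComplement hY hEc' _ fun h => absurd h hne)
  rcases hE'.isDegenerate_or with hdeg | ⟨D', -, hDd', hDo'⟩
  · refine absurd (hasFiniteComplement hY hEc' _ fun _ => ?_) hgv
    rw [hdeg.subsingleton.finite.isClosed.closure_eq]
    exact hdeg.subsingleton
  · have himg := image_spine g (fanOver.ray d 1)
    rw [fanOver.spine_eq hDd hDo isClosed_closure hv,
      fanOver.spine_eq hDd' hDo' isClosed_closure hgv1] at himg
    obtain ⟨k, -⟩ := exists_homeomorph_of_image_range
      fanOver.isClosedEmbedding_base.isEmbedding fanOver.isClosedEmbedding_base.isEmbedding g himg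
    exact ⟨k⟩

/-- Sequences whose connected coding spaces are homeomorphic match under a homeomorphism of the
base spaces. -/
theorem exists_forall₂_of_connectedCode [ConnectedSpace X] [ConnectedSpace Y]
    (hX : ∀ x : X, ¬ IsCutPoint x) (hY : ∀ y : Y, ¬ IsCutPoint y)
    (hE : (self X).Extends L E) (hE' : (self Y).Extends L' E')
    (hL : ∀ A ∈ L, ∀ x : X, IsOpen {x} → x ∈ A) (hL' : ∀ B ∈ L', ∀ y : Y, IsOpen {y} → y ∈ B)
    (g : E.ConnectedCode ≃ₜ E'.ConnectedCode) :
    ∃ f : X ≃ₜ Y, List.Forall₂ (fun A B => f '' A = B) L L' := by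
  by_cases hdeg : IsDegenerate L E ∧ IsDegenerate L' E'
  · exact hdeg.1.exists_homeomorph hdeg.2 hX hY (hE.isCompactOver isCompactOver_self)
      (hE'.isCompactOver isCompactOver_self) g
  · obtain ⟨h⟩ : Nonempty (E.carrier ≃ₜ E'.carrier) := by
      rcases not_and_or.1 hdeg with hdeg | hdeg
      · exact exists_homeomorph_carrier hY hE hE' hdeg g
      · exact (exists_homeomorph_carrier hX hE' hE hdeg g.symm).map Homeomorph.symm
    obtain ⟨f, -, hf⟩ := exists_base_homeomorph L hE hE' hL hL' h
    exact ⟨f, hf⟩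

end recognition

end SpaceOver

theorem theorem4 {X : Type u} {Y : Type v}
    [MetricSpace X] [CompactSpace X] [ConnectedSpace X]
    [MetricSpace Y] [CompactSpace Y] [ConnectedSpace Y]
    (hX : ∀ x : X, ¬ IsCutPoint x) (hY : ∀ y : Y, ¬ IsCutPoint y)
    (S : List (Set X)) (T : List (Set Y))
    (hS : ∀ A ∈ S, IsClosed A) (hT : ∀ B ∈ T, IsClosed B)
    (hS_isolated : ∀ A ∈ S, ∀ x : X, IsOpen {x} → x ∈ A)
    (hT_isolated : ∀ B ∈ T, ∀ y : Y, IsOpen {y} → y ∈ B)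
    (E : SpaceOver X) (F : SpaceOver Y)
    (hE : E.IsCodingSpace S) (hF : F.IsCodingSpace T) :
    SeqHomeomorphic S T ↔ Nonempty (E.ConnectedCode ≃ₜ F.ConnectedCode) := by
  constructor
  · rintro ⟨f, hf⟩
    obtain ⟨H, hH⟩ := hE.exists_homeomorph f hF ((forall₂_increasingSeq_iff f.toEquiv S T).2 hf)
      SpaceOver.isCompactOver_self SpaceOver.isCompactOver_self f fun _ => rfl
    refine fanOver.nonempty_homeomorph H ?_
    rw [H.image_closure]
    congr 1
    exact SpaceOver.image_added (f := f.toEquiv) (h := H.toEquiv) hH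
  · rintro ⟨g⟩
    obtain ⟨f, hf⟩ := SpaceOver.exists_forall₂_of_connectedCode hX hY hE hF
      (fun A hA x hx => mem_of_mem_increasingSeq S (fun B hB => hS_isolated B hB x hx) A hA)
      (fun A hA x hx => mem_of_mem_increasingSeq T (fun B hB => hT_isolated B hB x hx) A hA) g
    exact ⟨f, (forall₂_increasingSeq_iff f.toEquiv S T).1 hf⟩
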